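/- Let $d\ge 0$ be an integer, $\mu:\mathbb R^d\to\mathbb R^d$ and $\sigma:\mathbb R^d\to\mathbb R^{d\times d}$ functions, and $\Theta\subseteq\mathbb R^d$. Write $d(x,\Theta)=\inf_{y\in\Theta}\|x-y\|$ (with $\inf\emptyset=\infty$) and $\Theta^{\varepsilon}=\{x: d(x,\Theta)<\varepsilon\}$. For $A\subseteq\mathbb R^d$ and $x,y\in A$ let $\rho_A(x,y)\in[0,\infty]$ be the infimum of the lengths of the continuous curves in $A$ from $x$ to $y$ ($\infty$ if there is none). Assume: 1. $\Theta$ is a $C^3$ hypersurface (an embedded $(d-1)$-dimensional $C^3$ submanifold of $\mathbb R^d$) with finitely many connected components, and $\mu$ restricted to $\mathbb R^d\setminus\Theta$ is intrinsic Lipschitz: there is a constant $L$ with $\|\mu(x)-\mu(y)\|\le L\,\rho_{\mathbb R^d\setminus\Theta}(x,y)$ for all $x,y\in\mathbb R^d\setminus\Theta$. 2. There is given $\varepsilon_0>0$ such that every $x\in\Theta^{\varepsilon_0}$ has a unique closest point $p(x)$ on $\Theta$. 3. There is a constant $c_0>0$ such that $\|\sigma(\xi)^\top\nu\|\ge c_0$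 for every $\xi\in\Theta$ and each of the unit vectors $\nu$ orthogonal to the tangent space $\tau(\xi)$ of $\Theta$ at $\xi$. 4. There is a constant $a$ such that for every relatively open $B\subseteq\Theta$ and every $C^2$ unit normal field $n:B\to\mathbb R^d$ of $\Theta$, the function $$\alpha(\xi)=\lim_{h\to0+}\frac{\mu(\xi-h\,n(\xi))-\mu(\xi+h\,n(\xi))}{2\,n(\xi)^\top\sigma(\xi)\sigma(\xi)^\top n(\xi)},\qquad \xi\in B,$$ is $C^3$ on $B$, and its derivatives of orders $0,1,2,3$ are bounded in norm by $a$ on $B$. (The limit exists by assumptions 1 and 3. The derivatives at $\xi$ are those at $0$ of $\alpha\circ\psi_\xi$, where $\psi_\xi$ is the parametrization of $\Theta$ near $\xi$ as a graph over $\tau(\xi)$, that is, the local inverse of the orthogonal projection of $x-\xi$ to $\tau(\xi)$, $x\in\Theta$.) Let $\phi(u)=(1+u)^3(1-u)^3$ for $|u|\le1$ and $\phi(u)=0$ otherwise. For $c>0$ define $G=G_c:\mathbb R^d\to\mathbb R^d$ by $G(x)=x$ for $x\notin\Theta^{\varepsilon_0}$ and, for $x\in\Theta^{\varepsilon_0}$,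 $$G(x)=x+\tilde\phi(x)\,\alpha(p(x)),\qquad \tilde\phi(x)=\big((x-p(x))\cdot n(p(x))\big)\,\|x-p(x)\|\,\phi\!\left(\frac{\|x-p(x)\|}{c}\right),$$ where $n(p(x))$ is either of the unit normal vectors of $\Theta$ at $p(x)$ and $\alpha(p(x))$ is formed with the same vector (the product does not depend on the choice). Then there is $c_{\max}\in(0,\varepsilon_0]$ such that for every $c\in(0,c_{\max})$ the map $G$ is a $C^1$ diffeomorphism of $\mathbb R^d$ onto $\mathbb R^d$, i.e. $G$ is bijective and both $G$ and $G^{-1}$ are $C^1$. -/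

import Mathlib

open Set Filter Topology
open scoped Manifold ContDiff ENNReal NNReal

noncomputable section

namespace DriftTransform

/-- The Euclidean space `ℝ^d`. -/
abbrev Rd (d : ℕ) : Type := EuclideanSpace ℝ (Fin d)

variable {d : ℕ}

/-! ### Intrinsic Lipschitz functions -/

/-- The intrinsic metric of `A`: the infimum of the lengths of all continuous curves in `A` from
`x` to `y`, and `∞` if there is no such curve. -/
def intrinsicDist (A : Set (Rd d)) (x y : Rd d) : ℝ≥0∞ :=
  ⨅ (γ : ℝ → Rd d) (_ : ContinuousOn γ (Icc 0 1) ∧ MapsTo γ (Icc 0 1) A ∧ γ 0 = x ∧ γ 1 = y),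
    eVariationOn γ (Icc 0 1)

/-- `f` restricted to `A` is Lipschitz with respect to the intrinsic metric of `A`. -/
def IntrinsicLipschitzOn (f : Rd d → Rd d) (A : Set (Rd d)) : Prop :=
  ∃ L : ℝ≥0, ∀ x ∈ A, ∀ y ∈ A, edist (f x) (f y) ≤ L * intrinsicDist A x y

/-! ### Hypersurfaces -/

/-- `Θ` is a (`d - 1`)-dimensional embedded `C^k` submanifold of `ℝ^d` (`1 ≤ k`): locally it is the
zero set of a real `C^k` function without critical points. -/
def IsHypersurface (k : ℕ∞) (Θ : Set (Rd d)) : Prop :=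
  ∀ ξ ∈ Θ, ∃ U : Set (Rd d), IsOpen U ∧ ξ ∈ U ∧ ∃ f : Rd d → ℝ,
    ContDiffOn ℝ k f U ∧ (∀ x ∈ U, fderiv ℝ f x ≠ 0) ∧ Θ ∩ U = {x ∈ U | f x = 0}

/-- `Θ` is an exceptional set for `f`: a hypersurface with finitely many connected components such
that `f` is intrinsic Lipschitz on the complement of `Θ`. (A function is piecewise Lipschitz if it has
an exceptional set.) -/
def IsExceptionalSet (f : Rd d → Rd d) (Θ : Set (Rd d)) : Prop :=
  IsHypersurface 1 Θ ∧ Finite (ConnectedComponents Θ) ∧ IntrinsicLipschitzOn f Θᶜ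

/-- `q` is a point of `Θ` that is closest to `x`. -/
def IsClosestPoint (Θ : Set (Rd d)) (x q : Rd d) : Prop :=
  q ∈ Θ ∧ dist x q = Metric.infDist x Θ

/-- Every `x` with `d(x, Θ) < ε` has a unique closest point on `Θ`. (`Metric.thickening ε Θ` is
`{x | d(x, Θ) < ε}`, with `d(x, ∅) = ∞`.) -/
def HasUniqueClosestPoints (Θ : Set (Rd d)) (ε : ℝ) : Prop :=
  ∀ x ∈ Metric.thickening ε Θ, ∃! q, IsClosestPoint Θ x q

/-- The closest point projection `p`. -/
def closestPoint (Θ : Set (Rd d)) (x : Rd d) : Rd d :=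
  Classical.epsilon (IsClosestPoint Θ x)

/-- The tangent space of `Θ` at `ξ` (for a hypersurface the tangent cone is itself a linear
space). -/
def tangentSpaceAt (Θ : Set (Rd d)) (ξ : Rd d) : Submodule ℝ (Rd d) :=
  Submodule.span ℝ (tangentConeAt ℝ Θ ξ)

/-- `ν` is one of the two unit vectors orthogonal to the tangent space of `Θ` at `ξ`. -/
def IsUnitNormal (Θ : Set (Rd d)) (ξ ν : Rd d) : Prop :=
  ‖ν‖ = 1 ∧ ∀ v ∈ tangentSpaceAt Θ ξ, inner ℝ ν v = 0

/-- A choice of unit normal vector at a point. -/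
def unitNormal (Θ : Set (Rd d)) (ξ : Rd d) : Rd d :=
  Classical.epsilon (IsUnitNormal Θ ξ)

/-- `f` is a `C^k` function on the set `S ⊆ ℝ^d`: near each point of `S` it has a `C^k` extension
to an open subset of `ℝ^d`. -/
def IsCkOn (k : ℕ∞) (f : Rd d → Rd d) (S : Set (Rd d)) : Prop :=
  ∀ ξ ∈ S, ∃ U : Set (Rd d), IsOpen U ∧ ξ ∈ U ∧ ∃ g : Rd d → Rd d,
    ContDiffOn ℝ k g U ∧ EqOn f g (S ∩ U)

/-- `n` is a `C²` unit normal vector field on the relatively open subset `Θ ∩ V` of `Θ`. -/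
def IsUnitNormalFieldOn (Θ V : Set (Rd d)) (n : Rd d → Rd d) : Prop :=
  IsOpen V ∧ (∀ ξ ∈ Θ ∩ V, IsUnitNormal Θ ξ (n ξ)) ∧ IsCkOn 2 n (Θ ∩ V)

/-- `ψ` is the `C^k` parametrization of `Θ` near `ξ` as a graph over the tangent space at `ξ`: the
local inverse of the orthogonal projection `x ↦ P (x - ξ)` restricted to `Θ`. Its germ at `0` is
determined by `Θ` and `ξ`. -/
structure IsTangentGraph (k : ℕ∞) (Θ : Set (Rd d)) (ξ : Rd d)
    (ψ : tangentSpaceAt Θ ξ → Rd d) : Prop where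
  contDiffAt : ContDiffAt ℝ k ψ 0
  map_zero : ψ 0 = ξ
  eventually_mem : ∀ᶠ v in 𝓝 (0 : tangentSpaceAt Θ ξ), ψ v ∈ Θ
  eventually_proj : ∀ᶠ v in 𝓝 (0 : tangentSpaceAt Θ ξ),
    (tangentSpaceAt Θ ξ).orthogonalProjectionOnto (ψ v - ξ) = v

/-- The derivatives of orders `0, …, k` at `ξ` of the function `f` on the hypersurface `Θ`, taken in
the graph parametrization of `Θ` over the tangent space at `ξ`, are bounded by `a` in operator norm.
(Order `0` is the value `f ξ`, and order `1` the derivative of `f` on the tangent space.) -/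
def DerivsBoundedAt (k : ℕ) (Θ : Set (Rd d)) (f : Rd d → Rd d) (ξ : Rd d) (a : ℝ) : Prop :=
  ∀ ψ : tangentSpaceAt Θ ξ → Rd d, IsTangentGraph k Θ ξ ψ →
    ∀ j ≤ k, ‖iteratedFDeriv ℝ j (fun v => f (ψ v)) 0‖ ≤ a

/-! ### The transform -/

/-- The bump function `φ`. -/
def bump (u : ℝ) : ℝ :=
  if |u| ≤ 1 then (1 + u) ^ 3 * (1 - u) ^ 3 else 0

/-- `σ(ξ)ᵀ ν`. -/
def transposeMul (σ : Rd d → Matrix (Fin d) (Fin d) ℝ) (ξ ν : Rd d) : Rd d :=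
  Matrix.toEuclideanLin (σ ξ).transpose ν

/-- The vector `α(ξ)` formed with the unit normal vector `ν` at `ξ`,
`lim_{h → 0+} (μ(ξ - h ν) - μ(ξ + h ν)) / (2 νᵀ σ(ξ) σ(ξ)ᵀ ν)`. -/
def alpha (μ : Rd d → Rd d) (σ : Rd d → Matrix (Fin d) (Fin d) ℝ) (ν ξ : Rd d) : Rd d :=
  limUnder (𝓝[>] (0 : ℝ)) fun h : ℝ =>
    (2 * inner ℝ ν (Matrix.toEuclideanLin (σ ξ * (σ ξ).transpose) ν))⁻¹ •
      (μ (ξ - h • ν) - μ (ξ + h • ν))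

/-- `φ̃(x) = (x - q) · ν ‖x - q‖ φ(‖x - q‖ / c)`, where `q` stands for the closest point `p(x)` and
`ν` for the unit normal vector there. -/
def phiTilde (c : ℝ) (q ν x : Rd d) : ℝ :=
  inner ℝ (x - q) ν * ‖x - q‖ * bump (‖x - q‖ / c)

open scoped Classical in
/-- The transform `G`. Replacing the unit normal vector at `p(x)` by its negative changes the sign of
both factors `φ̃(x)` and `α(p(x))`, so that the choice made in `unitNormal` is irrelevant. -/
def transform (μ : Rd d → Rd d) (σ : Rd d → Matrix (Fin d) (Fin d) ℝ) (Θ : Set (Rd d))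
    (ε₀ c : ℝ) (x : Rd d) : Rd d :=
  if x ∈ Metric.thickening ε₀ Θ then
    x + phiTilde c (closestPoint Θ x) (unitNormal Θ (closestPoint Θ x)) x •
      alpha μ σ (unitNormal Θ (closestPoint Θ x)) (closestPoint Θ x)
  else x

end DriftTransform

end

/-!
`G` is a small `C¹` perturbation of the identity: for small `c`, the map `G - id` is `C¹` on `ℝ^d` and
its derivative has norm at most `1 / 2` everywhere, so that `G` is a homeomorphism with a `C¹` inverse
(`exists_diffeomorph_of_norm_fderiv_sub_le`). Where the distance to `Θ` exceeds `c` this is clear, as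
`G = id` there (`transform_eq_self`).

Near `Θ` everything rests on a uniform control of the closest point projection `p`. Let
`0 < r = d(x₀, Θ) < ε₀`. Since `p` is single valued, hence continuous, on the tube `Θ^{ε₀}`, the
maximum of `d(·, Θ)` on the ball of radius `s` about `x₀` grows at rate `1` in `s` as long as
`r + s < ε₀`. The maximum is thus `r + s`, which by strict convexity can only be attained on the ray
from `p(x₀)` through `x₀`. Hence closest points persist along normal rays up to distance `ε₀`
(`HasUniqueClosestPoints.infDist_add_smul`). Together with the second order Taylor estimate for a
defining function, this shows that every normal segment of length less than `ε₀` realizes the distance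
to `Θ` (`IsLocalGraph.infDist_add_smul`). So `Θ` has positive reach, and `p` is `2`-Lipschitz on the
tube of radius `ε₀ / 4` (`HasUniqueClosestPoints.norm_closestPoint_sub_le`).

In normal coordinates `(v, t) ↦ ψ(v) + t n(ψ(v))`, where `ψ` is the graph parametrization of `Θ` over
its tangent space, the Lipschitz bounds for `p` and for the distance show that the coordinate map cannot
contract, so the inverse function theorem applies at every point of the tube, and both coordinates have
derivatives bounded by absolute constants (`IsLocalGraph.exists_coordinates`). There `G - id` is
`t |t| φ(|t| / c) α(ψ(v))`, a product of a function of size `c²` with derivative of size `c` and of a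
function with value and derivative bounded by `a` (`contDiffAt_transform_sub`). The formula for `G`
uses an arbitrary choice of the normal vector at each point. It may be replaced by a smooth local choice
because the limit defining `α` exists, by the intrinsic Lipschitz property along normal segments
(`IsLocalGraph.phiTilde_smul_alpha`).
-/

namespace DriftTransform

/-! ### Closest points -/

section ClosestPoint

variable {d : ℕ} {Θ : Set (Rd d)} {ε : ℝ}

lemma infDist_lt_of_mem_thickening {x : Rd d} (hx : x ∈ Metric.thickening ε Θ) :
    Θ.Nonempty ∧ Metric.infDist x Θ < ε := by
  have hne : Θ.Nonempty := by
    obtain ⟨z, hz, _⟩ := Metric.mem_thickening_iff.1 hx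
    exact ⟨z, hz⟩
  exact ⟨hne, (Metric.mem_thickening_iff_infDist_lt hne).1 hx⟩

lemma HasUniqueClosestPoints.isClosestPoint_closestPoint (h : HasUniqueClosestPoints Θ ε)
    {x : Rd d} (hx : x ∈ Metric.thickening ε Θ) : IsClosestPoint Θ x (closestPoint Θ x) :=
  Classical.epsilon_spec (h x hx).exists

lemma HasUniqueClosestPoints.closestPoint_eq (h : HasUniqueClosestPoints Θ ε)
    {x q : Rd d} (hx : x ∈ Metric.thickening ε Θ) (hq : IsClosestPoint Θ x q) :
    closestPoint Θ x = q :=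
  (h x hx).unique (h.isClosestPoint_closestPoint hx) hq

lemma HasUniqueClosestPoints.isClosed (hε : 0 < ε) (h : HasUniqueClosestPoints Θ ε) :
    IsClosed Θ := by
  rw [← closure_subset_iff_isClosed]
  intro x hx
  have hx' : x ∈ Metric.thickening ε Θ := Metric.closure_subset_thickening hε Θ hx
  obtain ⟨hq, hd⟩ := h.isClosestPoint_closestPoint hx'
  rw [Metric.mem_closure_iff_infDist_zero (infDist_lt_of_mem_thickening hx').1] at hx
  rw [hx, dist_eq_zero] at hd
  rwa [hd]

lemma HasUniqueClosestPoints.continuousAt (hε : 0 < ε) (h : HasUniqueClosestPoints Θ ε)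
    {x : Rd d} (hx : x ∈ Metric.thickening ε Θ) : ContinuousAt (closestPoint Θ) x := by
  have hcl := h.isClosed hε
  have hev : ∀ᶠ x' in 𝓝 x, IsClosestPoint Θ x' (closestPoint Θ x') := by
    filter_upwards [Metric.isOpen_thickening.mem_nhds hx] with x' hx'
    exact h.isClosestPoint_closestPoint hx'
  have hb : ∀ᶠ x' in 𝓝 x, closestPoint Θ x' ∈ Metric.closedBall x (ε + 2) := by
    filter_upwards [hev, Metric.ball_mem_nhds x one_pos] with x' hx' hxx
    rw [Metric.mem_ball] at hxx
    have h1 := (infDist_lt_of_mem_thickening hx).2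
    have h2 : Metric.infDist x' Θ ≤ Metric.infDist x Θ + dist x' x := Metric.infDist_le_infDist_add_dist
    have h3 := dist_triangle_left (closestPoint Θ x') x x'
    rw [hx'.2] at h3
    rw [Metric.mem_closedBall]
    linarith
  refine (isCompact_closedBall x (ε + 2)).tendsto_nhds_of_unique_mapClusterPt hb ?_
  intro y _ hy
  have hyΘ : y ∈ Θ := by
    refine hcl.mem_of_frequently_of_tendsto (b := 𝓝 x ⊓ comap (closestPoint Θ) (𝓝 y))
      (f := closestPoint Θ) ?_ (tendsto_comap.mono_left inf_le_right)
    have : (𝓝 x ⊓ comap (closestPoint Θ) (𝓝 y)).NeBot := by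
      have := mapClusterPt_iff_ultrafilter.1 hy
      obtain ⟨U, hU, hUy⟩ := this
      exact U.neBot.mono (le_inf hU (tendsto_iff_comap.1 hUy))
    exact (hev.filter_mono inf_le_left).frequently.mono fun _ h => h.1
  refine (h.closestPoint_eq hx ⟨hyΘ, le_antisymm ?_ ?_⟩).symm
  · refine le_of_forall_pos_le_add fun δ hδ => ?_
    have h1 : ∃ᶠ x' in 𝓝 x, closestPoint Θ x' ∈ Metric.ball y (δ / 3) :=
      hy.frequently (Metric.ball_mem_nhds y (by positivity))
    obtain ⟨x', ⟨hy', hx'⟩, hxx⟩ :=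
      ((h1.and_eventually hev).and_eventually (Metric.ball_mem_nhds x (by positivity : 0 < δ / 3))).exists
    have h2 : Metric.infDist x' Θ ≤ Metric.infDist x Θ + dist x' x := Metric.infDist_le_infDist_add_dist
    rw [Metric.mem_ball] at hy'
    have h3 := dist_triangle4 x x' (closestPoint Θ x') y
    rw [hx'.2, dist_comm x x'] at h3
    linarith
  · exact Metric.infDist_le_dist_of_mem hyΘ

/-! ### Extending normal segments -/

/-- Moving from `x` straight away from its closest point, the distance to `Θ` grows at a rate
arbitrarily close to `1`: by continuity the closest point hardly moves. -/
lemma HasUniqueClosestPoints.exists_infDist_ge (hε : 0 < ε) (h : HasUniqueClosestPoints Θ ε)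
    {x : Rd d} (hx : x ∈ Metric.thickening ε Θ) (hpos : 0 < Metric.infDist x Θ)
    {η ρ : ℝ} (hη : 0 < η) (hη1 : η ≤ 1) (hρ : 0 < ρ) :
    ∃ k, 0 < k ∧ k < ρ ∧ ∃ x', dist x' x ≤ k ∧
      Metric.infDist x Θ + (1 - η) * k ≤ Metric.infDist x' Θ := by
  set q := closestPoint Θ x with hq
  set D := Metric.infDist x Θ with hD
  have hqx : ‖x - q‖ = D := by
    rw [← dist_eq_norm]; exact (h.isClosestPoint_closestPoint hx).2
  set u : Rd d := D⁻¹ • (x - q) with hu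
  have hun : ‖u‖ = 1 := by
    rw [hu, norm_smul, hqx, norm_inv, Real.norm_of_nonneg hpos.le, inv_mul_cancel₀ hpos.ne']
  have hcur : Tendsto (fun k : ℝ => x + k • u) (𝓝[>] 0) (𝓝 x) := by
    have : Continuous (fun k : ℝ => x + k • u) := by fun_prop
    have h1 := this.tendsto 0
    simp only [zero_smul, add_zero] at h1
    exact h1.mono_left nhdsWithin_le_nhds
  have hlim : Tendsto (fun k : ℝ => inner ℝ u (x - closestPoint Θ (x + k • u))) (𝓝[>] 0) (𝓝 D) := by
    have h1 : Tendsto (fun k : ℝ => closestPoint Θ (x + k • u)) (𝓝[>] 0) (𝓝 q) :=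
      (h.continuousAt hε hx).tendsto.comp hcur
    have h2 := (tendsto_const_nhds (x := u)).inner (𝕜 := ℝ) ((tendsto_const_nhds (x := x)).sub h1)
    have h3 : inner ℝ u (x - q) = D := by
      rw [hu, real_inner_smul_left, real_inner_self_eq_norm_sq, hqx]
      field_simp
    rwa [h3] at h2
  have e1 := hlim.eventually (lt_mem_nhds (show D * (1 - η / 2) < D by nlinarith))
  have e2 : ∀ᶠ k : ℝ in 𝓝[>] 0, k ∈ Ioo 0 ρ := Ioo_mem_nhdsGT hρ
  have e3 := hcur.eventually (Metric.isOpen_thickening.mem_nhds hx)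
  obtain ⟨k, ⟨k1, k2⟩, k3⟩ := ((e1.and e2).and e3).exists
  have hk0 := k2.1
  refine ⟨k, hk0, k2.2, x + k • u, ?_, ?_⟩
  · rw [dist_eq_norm, add_sub_cancel_left, norm_smul, hun, Real.norm_of_nonneg hk0.le, mul_one]
  · set y := closestPoint Θ (x + k • u)
    obtain ⟨hy, hyd⟩ := h.isClosestPoint_closestPoint k3
    have h1 : D ≤ ‖x - y‖ := by
      rw [← dist_eq_norm]; exact Metric.infDist_le_dist_of_mem hy
    have h2 : Metric.infDist (x + k • u) Θ ^ 2 = ‖x - y‖ ^ 2 + 2 * k * inner ℝ u (x - y) + k ^ 2 := by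
      rw [← hyd, dist_eq_norm, show x + k • u - y = (x - y) + k • u by abel, norm_add_sq_real,
        norm_smul, hun, real_inner_smul_right, real_inner_comm, Real.norm_of_nonneg hk0.le]
      ring
    have h3 : D ^ 2 ≤ ‖x - y‖ ^ 2 := by gcongr
    refine (abs_le_of_sq_le_sq' ?_ Metric.infDist_nonneg).2
    rw [h2]
    have : 2 * k * (D * (1 - η / 2)) ≤ 2 * k * inner ℝ u (x - y) := by gcongr
    nlinarith [mul_pos (mul_pos hk0 hη) hpos, mul_nonneg (mul_pos hk0 hk0).le
      (mul_nonneg hη.le (sub_nonneg.2 hη1)), mul_pos (mul_pos hk0 hη) hk0]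

/-- If `x₀` has closest point `q`, at distance `r`, then `q` remains the closest point along the ray
from `q` through `x₀` up to distance `ε`. -/
theorem HasUniqueClosestPoints.infDist_add_smul (hε : 0 < ε) (h : HasUniqueClosestPoints Θ ε)
    {q u : Rd d} (hq : q ∈ Θ) (hu : ‖u‖ = 1) {r t : ℝ} (hr : 0 < r)
    (hrd : Metric.infDist (q + r • u) Θ = r) (hrt : r ≤ t) (ht : t < ε) :
    Metric.infDist (q + t • u) Θ = t := by
  have hne : Θ.Nonempty := ⟨q, hq⟩
  set x₀ := q + r • u with hx₀
  set s := t - r with hs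
  have hs0 : 0 ≤ s := by linarith
  have hcont : Continuous fun x : Rd d => Metric.infDist x Θ := Metric.continuous_infDist_pt Θ
  -- the distance to `Θ` reaches almost the largest possible value `r + s` on the ball of radius `s`
  have key : ∀ η : ℝ, 0 < η → η ≤ 1 →
      ∃ x, dist x x₀ ≤ s ∧ r + (1 - η) * s ≤ Metric.infDist x Θ := by
    intro η hη hη1
    set S : Set ℝ := {τ | ∃ x, dist x x₀ ≤ τ ∧ r + (1 - η) * τ ≤ Metric.infDist x Θ} with hS
    have hclosed : IsClosed (S ∩ Icc 0 s) := by
      set K : Set (ℝ × Rd d) := (Icc 0 s ×ˢ Metric.closedBall x₀ s) ∩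
        {z | dist z.2 x₀ ≤ z.1 ∧ r + (1 - η) * z.1 ≤ Metric.infDist z.2 Θ} with hK
      have hKc : IsCompact K := by
        refine (isCompact_Icc.prod (isCompact_closedBall x₀ s)).inter_right ?_
        have c1 : Continuous fun z : ℝ × Rd d => dist z.2 x₀ := by fun_prop
        have c2 : Continuous fun z : ℝ × Rd d => r + (1 - η) * z.1 := by fun_prop
        exact (isClosed_le c1 continuous_fst).inter
          (isClosed_le c2 (hcont.comp continuous_snd))
      have : S ∩ Icc 0 s = Prod.fst '' K := by
        ext τ
        constructor
        · rintro ⟨⟨x, hx1, hx2⟩, hτ⟩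
          exact ⟨(τ, x), ⟨⟨hτ, Metric.mem_closedBall.2 (hx1.trans hτ.2)⟩, hx1, hx2⟩, rfl⟩
        · rintro ⟨⟨τ', x⟩, ⟨⟨hτ, _⟩, hx1, hx2⟩, rfl⟩
          exact ⟨⟨x, hx1, hx2⟩, hτ⟩
      rw [this]
      exact (hKc.image continuous_fst).isClosed
    have hsub : Icc 0 s ⊆ S := by
      refine hclosed.Icc_subset_of_forall_exists_gt ⟨x₀, by simp, by simp [hrd]⟩ ?_
      rintro τ ⟨⟨x, hx1, hx2⟩, hτ⟩ τ' hτ'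
      have h1 : Metric.infDist x Θ ≤ r + τ := by
        have : Metric.infDist x Θ ≤ Metric.infDist x₀ Θ + dist x x₀ :=
          Metric.infDist_le_infDist_add_dist
        linarith
      have hpos : 0 < Metric.infDist x Θ := by
        have : 0 ≤ (1 - η) * τ := mul_nonneg (by linarith) hτ.1
        linarith
      have hx : x ∈ Metric.thickening ε Θ := by
        rw [Metric.mem_thickening_iff_infDist_lt hne]
        linarith [hτ.2]
      obtain ⟨k, hk0, hk, x', hx'1, hx'2⟩ :=
        h.exists_infDist_ge hε hx hpos hη hη1 (sub_pos.2 (mem_Ioi.1 hτ'))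
      refine ⟨τ + k, ⟨x', ?_, ?_⟩, by linarith, by linarith⟩
      · linarith [dist_triangle x' x x₀]
      · nlinarith
    exact hsub (right_mem_Icc.2 hs0)
  obtain ⟨x, hx1, hx2⟩ : ∃ x, dist x x₀ ≤ s ∧ r + s ≤ Metric.infDist x Θ := by
    obtain ⟨x, hx, hmax⟩ := (isCompact_closedBall x₀ s).exists_isMaxOn
      ⟨x₀, Metric.mem_closedBall_self hs0⟩ hcont.continuousOn
    refine ⟨x, hx, ?_⟩
    by_contra! hlt
    have hη0 : 0 < (r + s - Metric.infDist x Θ) / (s + 1) / 2 := by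
      have : 0 < s + 1 := by linarith
      have : 0 < r + s - Metric.infDist x Θ := by linarith
      positivity
    obtain ⟨x', hx'1, hx'2⟩ := key (min 1 ((r + s - Metric.infDist x Θ) / (s + 1) / 2))
      (lt_min one_pos hη0) (min_le_left _ _)
    have h1 : Metric.infDist x' Θ ≤ Metric.infDist x Θ := hmax (Metric.mem_closedBall.2 hx'1)
    have h2 := min_le_right 1 ((r + s - Metric.infDist x Θ) / (s + 1) / 2)
    have h3 : min 1 ((r + s - Metric.infDist x Θ) / (s + 1) / 2) * s ≤
        (r + s - Metric.infDist x Θ) / (s + 1) / 2 * (s + 1) := by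
      gcongr
      linarith
    have h4 : (r + s - Metric.infDist x Θ) / (s + 1) / 2 * (s + 1) =
        (r + s - Metric.infDist x Θ) / 2 := by
      have : s + 1 ≠ 0 := by linarith
      field_simp
    linarith
  -- the maximum is attained at a single point, by strict convexity of the norm
  have hxq : r + s ≤ ‖(x - x₀) + r • u‖ := by
    have : (x - x₀) + r • u = x - q := by rw [hx₀]; abel
    rw [this, ← dist_eq_norm]
    exact hx2.trans (Metric.infDist_le_dist_of_mem hq)
  have hxs : ‖x - x₀‖ ≤ s := by rwa [← dist_eq_norm]
  have hin : s ≤ inner ℝ (x - x₀) u := by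
    have h1 : (r + s) ^ 2 ≤ ‖(x - x₀) + r • u‖ ^ 2 := by gcongr
    rw [norm_add_sq_real, norm_smul, hu, real_inner_smul_right, Real.norm_of_nonneg hr.le] at h1
    have h2 : ‖x - x₀‖ ^ 2 ≤ s ^ 2 := by gcongr
    nlinarith
  have hxe : x - x₀ = s • u := by
    have h1 : ‖(x - x₀) - s • u‖ ^ 2 ≤ 0 := by
      rw [norm_sub_sq_real, norm_smul, hu, real_inner_smul_right, Real.norm_of_nonneg hs0]
      have h2 : ‖x - x₀‖ ^ 2 ≤ s ^ 2 := by gcongr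
      nlinarith
    have h2 : ‖(x - x₀) - s • u‖ = 0 := by nlinarith [norm_nonneg ((x - x₀) - s • u)]
    exact sub_eq_zero.1 (norm_eq_zero.1 h2)
  have hxt : x = q + t • u := by
    rw [sub_eq_iff_eq_add.1 hxe, hx₀, hs]
    module
  refine le_antisymm ?_ ?_
  · refine (Metric.infDist_le_dist_of_mem hq).trans ?_
    rw [dist_eq_norm, add_sub_cancel_left, norm_smul, hu, Real.norm_of_nonneg (by linarith), mul_one]
  · rw [← hxt]
    linarith

end ClosestPoint

/-! ### Local description of a hypersurface -/

section Local

variable {d : ℕ} {Θ : Set (Rd d)}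

/-- The orthogonal projection of `ℝ^d` along the vector `ν` (onto its orthogonal complement, if `ν`
is a unit vector). -/
noncomputable def projPerp (ν : Rd d) : Rd d →L[ℝ] Rd d :=
  ContinuousLinearMap.id ℝ (Rd d) - (innerSL ℝ ν).smulRight ν

lemma projPerp_apply (ν w : Rd d) : projPerp ν w = w - inner ℝ ν w • ν := by
  simp [projPerp]

lemma inner_projPerp {ν : Rd d} (hν : ‖ν‖ = 1) (w : Rd d) : inner ℝ ν (projPerp ν w) = 0 := by
  rw [projPerp_apply, inner_sub_right, real_inner_smul_right, real_inner_self_eq_norm_sq, hν]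
  ring

lemma projPerp_of_inner_eq_zero {ν w : Rd d} (h : inner ℝ ν w = 0) : projPerp ν w = w := by
  rw [projPerp_apply, h, zero_smul, sub_zero]

lemma norm_projPerp_le {ν : Rd d} (hν : ‖ν‖ = 1) (w : Rd d) : ‖projPerp ν w‖ ≤ ‖w‖ := by
  have h : ‖projPerp ν w‖ ^ 2 ≤ ‖w‖ ^ 2 := by
    rw [projPerp_apply, norm_sub_sq_real, norm_smul, hν, real_inner_smul_right, real_inner_comm,
      mul_one, Real.norm_eq_abs, sq_abs]
    nlinarith [sq_nonneg (inner ℝ w ν)]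
  exact abs_le_of_sq_le_sq' h (norm_nonneg _) |>.2

lemma eq_smul_of_inner_projPerp_eq_zero {ν z : Rd d} (hν : ‖ν‖ = 1)
    (h : inner ℝ z (projPerp ν z) = 0) : z = inner ℝ ν z • ν := by
  have h1 : ‖projPerp ν z‖ ^ 2 = 0 := by
    rw [← real_inner_self_eq_norm_sq]
    nth_rw 1 [projPerp_apply]
    rw [inner_sub_left, h, real_inner_smul_left, inner_projPerp hν]
    ring
  have h2 : projPerp ν z = 0 := norm_eq_zero.1 (pow_eq_zero_iff (by norm_num) |>.1 h1)
  rwa [projPerp_apply, sub_eq_zero] at h2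

/-- The description of a hypersurface `Θ` near its point `ξ` that is used below, `ν` being a unit
normal vector there. The graph parametrization `ψ` over the tangent space is extended to `ℝ^d` so as
to be constant in the direction `ν`. -/
structure IsLocalGraph (Θ : Set (Rd d)) (ξ ν : Rd d) (ψ : Rd d → Rd d) : Prop where
  norm_eq : ‖ν‖ = 1
  tangentSpaceAt_eq : tangentSpaceAt Θ ξ = (ℝ ∙ ν)ᗮ
  contDiffAt : ContDiffAt ℝ 3 ψ 0
  map_zero : ψ 0 = ξ
  hasFDerivAt : HasFDerivAt ψ (projPerp ν) 0
  eventually_mem : ∀ᶠ w in 𝓝 (0 : Rd d), ψ w ∈ Θ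
  eventually_proj : ∀ᶠ w in 𝓝 (0 : Rd d), projPerp ν (ψ w - ξ) = projPerp ν w
  map_projPerp : ∀ w, ψ (projPerp ν w) = ψ w
  inner_le : ∃ K : ℝ, ∀ᶠ y in 𝓝 ξ, y ∈ Θ → |inner ℝ ν (y - ξ)| ≤ K * ‖y - ξ‖ ^ 2

lemma exists_continuousLinearEquiv_of_injective {T : Rd d →L[ℝ] Rd d}
    (hT : Function.Injective T) : ∃ e : Rd d ≃L[ℝ] Rd d, (e : Rd d →L[ℝ] Rd d) = T :=
  ⟨(LinearEquiv.ofInjectiveEndo (T : Rd d →ₗ[ℝ] Rd d) hT).toContinuousLinearEquiv, by ext1; rfl⟩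

/-- The Riesz isomorphism of `ℝ^d`, as a linear map. -/
lemma exists_riesz (d : ℕ) : ∃ J : (Rd d →L[ℝ] ℝ) →L[ℝ] Rd d,
    ∀ l w, inner ℝ (J l) w = l w := by
  let b := EuclideanSpace.basisFun (Fin d) ℝ
  refine ⟨∑ i, (ContinuousLinearMap.apply ℝ ℝ (b i)).smulRight (b i), fun l w => ?_⟩
  conv_rhs => rw [← b.sum_repr' w]
  simp [sum_inner, real_inner_smul_left, mul_comm]

lemma exists_isLocalGraph_of_fderiv {U : Set (Rd d)} (hU : IsOpen U) {ξ : Rd d} (hξU : ξ ∈ U)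
    (hξ : ξ ∈ Θ) {f : Rd d → ℝ} (hf : ContDiffOn ℝ 3 f U) (hfU : Θ ∩ U = {x ∈ U | f x = 0})
    {ν : Rd d} (hν : ‖ν‖ = 1) {a : ℝ} (ha : a ≠ 0) (hfa : ∀ w, fderiv ℝ f ξ w = a * inner ℝ ν w) :
    ∃ ψ, IsLocalGraph Θ ξ ν ψ := by
  have hfξ : ContDiffAt ℝ 3 f ξ := hf.contDiffAt (hU.mem_nhds hξU)
  have hfd : HasFDerivAt f (fderiv ℝ f ξ) ξ :=
    (hfξ.differentiableAt (by norm_num)).hasFDerivAt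
  have hzero : ∀ x ∈ U, x ∈ Θ ↔ f x = 0 := by
    intro x hx
    have := Set.ext_iff.1 hfU x
    simp only [mem_inter_iff, hx, and_true, mem_ofPred_eq, true_and] at this
    exact this
  -- `Θ` is straightened by `H`, whose local inverse gives the graph parametrization
  set H : Rd d → Rd d := fun x => projPerp ν (x - ξ) + f x • ν with hH
  have hHc : ContDiffAt ℝ 3 H ξ := by
    have h1 : ContDiffAt ℝ 3 (fun x => projPerp ν (x - ξ)) ξ :=
      (projPerp ν).contDiff.contDiffAt.comp ξ (contDiffAt_id.sub contDiffAt_const)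
    exact h1.add (hfξ.smul contDiffAt_const)
  set H' : Rd d →L[ℝ] Rd d := projPerp ν + (fderiv ℝ f ξ).smulRight ν with hH'
  have hHd : HasFDerivAt H H' ξ := by
    have h1 : HasFDerivAt (fun x => projPerp ν (x - ξ)) (projPerp ν) ξ := by
      have := (projPerp ν).hasFDerivAt.comp ξ ((hasFDerivAt_id ξ).sub_const ξ)
      rwa [ContinuousLinearMap.comp_id] at this
    exact h1.add (hfd.smul_const ν)
  have hH'a : ∀ w, H' w = projPerp ν w + (a * inner ℝ ν w) • ν := by
    intro w
    simp [hH', hfa]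
  have hinj : Function.Injective H' := by
    rw [injective_iff_map_eq_zero]
    intro w hw
    rw [hH'a] at hw
    have h1 := congrArg (fun z => inner ℝ ν z) hw
    simp only [inner_add_right, inner_projPerp hν, real_inner_smul_right,
      real_inner_self_eq_norm_sq, hν, inner_zero_right] at h1
    have h2 : inner ℝ ν w = 0 := by
      have : a * inner ℝ ν w = 0 := by linarith
      exact (mul_eq_zero.1 this).resolve_left ha
    rw [h2, mul_zero, zero_smul, add_zero, projPerp_of_inner_eq_zero h2] at hw
    exact hw
  obtain ⟨e, he⟩ := exists_continuousLinearEquiv_of_injective hinj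
  have hHξ : H ξ = 0 := by
    simp [hH, (hzero ξ hξU).1 hξ]
  have hHe : HasFDerivAt H (e : Rd d →L[ℝ] Rd d) ξ := by rwa [he]
  have hHs : HasStrictFDerivAt H (e : Rd d →L[ℝ] Rd d) ξ :=
    hHc.hasStrictFDerivAt' hHe (by norm_num)
  set g := hHc.localInverse hHe (by norm_num) with hg
  have hgc : ContDiffAt ℝ 3 g 0 := by
    have := hHc.to_localInverse hHe (by norm_num)
    rwa [hHξ] at this
  have hg0 : g 0 = ξ := by
    have := hHc.localInverse_apply_image hHe (by norm_num)
    rwa [hHξ] at this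
  have hgd : HasFDerivAt g (e.symm : Rd d →L[ℝ] Rd d) 0 := by
    have := hHs.to_localInverse.hasFDerivAt
    rwa [hHξ] at this
  have hgr : ∀ᶠ y in 𝓝 (0 : Rd d), H (g y) = y := by
    have := hHs.eventually_right_inverse
    rwa [hHξ] at this
  have hPt : Tendsto (projPerp ν) (𝓝 0) (𝓝 0) := by
    have := (projPerp ν).continuous.tendsto 0
    rwa [map_zero] at this
  have hPP : ∀ w, projPerp ν (projPerp ν w) = projPerp ν w := fun w =>
    projPerp_of_inner_eq_zero (inner_projPerp hν w)
  set ψ : Rd d → Rd d := fun w => g (projPerp ν w) with hψ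
  have hψ0 : ψ 0 = ξ := by simp [hψ, hg0]
  have hψc : ContDiffAt ℝ 3 ψ 0 := by
    refine ContDiffAt.comp (0 : Rd d) ?_ (projPerp ν).contDiff.contDiffAt
    rwa [map_zero]
  have hψd : HasFDerivAt ψ (projPerp ν) 0 := by
    have hg' : HasFDerivAt g (e.symm : Rd d →L[ℝ] Rd d) (projPerp ν 0) := by rwa [map_zero]
    have h1 := hg'.comp (0 : Rd d) (projPerp ν).hasFDerivAt
    have h2 : ∀ w, e (projPerp ν w) = projPerp ν w := by
      intro w
      have : e (projPerp ν w) = H' (projPerp ν w) := by rw [← he]; rfl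
      rw [this, hH'a, inner_projPerp hν, mul_zero, zero_smul, add_zero, hPP]
    have h3 : (e.symm : Rd d →L[ℝ] Rd d).comp (projPerp ν) = projPerp ν := by
      refine ContinuousLinearMap.ext fun w => ?_
      exact (e.symm_apply_eq).2 (h2 w).symm
    rwa [h3] at h1
  have hψH : ∀ᶠ w in 𝓝 (0 : Rd d), f (ψ w) = 0 ∧ projPerp ν (ψ w - ξ) = projPerp ν w := by
    filter_upwards [hPt.eventually hgr] with w hw
    change projPerp ν (ψ w - ξ) + f (ψ w) • ν = projPerp ν w at hw
    have h1 := congrArg (fun z => inner ℝ ν z) hw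
    simp only [inner_add_right, inner_projPerp hν, real_inner_smul_right,
      real_inner_self_eq_norm_sq, hν] at h1
    have h2 : f (ψ w) = 0 := by linarith
    rw [h2, zero_smul, add_zero] at hw
    exact ⟨h2, hw⟩
  have hψU : ∀ᶠ w in 𝓝 (0 : Rd d), ψ w ∈ U := by
    refine hψc.continuousAt.eventually_mem ?_
    rw [hψ0]
    exact hU.mem_nhds hξU
  have hψΘ : ∀ᶠ w in 𝓝 (0 : Rd d), ψ w ∈ Θ := by
    filter_upwards [hψH, hψU] with w h1 h2
    exact (hzero _ h2).2 h1.1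
  refine ⟨ψ, hν, ?_, hψc, hψ0, hψd, hψΘ, hψH.mono fun w h => h.2, fun w => by simp [hψ, hPP], ?_⟩
  · apply le_antisymm
    · refine Submodule.span_le.2 fun v hv => ?_
      have h1 : HasFDerivWithinAt f (0 : Rd d →L[ℝ] ℝ) Θ ξ := by
        refine (hasFDerivWithinAt_const (0 : ℝ) ξ Θ).congr_of_eventuallyEq ?_ ((hzero ξ hξU).1 hξ)
        filter_upwards [self_mem_nhdsWithin, mem_nhdsWithin_of_mem_nhds (hU.mem_nhds hξU)]
          with x hx1 hx2
        exact (hzero x hx2).1 hx1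
      have h2 := hfd.hasFDerivWithinAt.unique_on h1 hv
      rw [hfa] at h2
      rw [SetLike.mem_coe, Submodule.mem_orthogonal_singleton_iff_inner_right]
      exact (mul_eq_zero.1 h2).resolve_left ha
    · intro w hw
      rw [Submodule.mem_orthogonal_singleton_iff_inner_right] at hw
      have h1 := (hψd.hasFDerivWithinAt (s := {w | ψ w ∈ Θ})).mapsTo_tangent_cone
        (show w ∈ tangentConeAt ℝ {w | ψ w ∈ Θ} 0 by
          rw [tangentConeAt_of_mem_nhds (show {w | ψ w ∈ Θ} ∈ 𝓝 0 from hψΘ)]; trivial)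
      rw [projPerp_of_inner_eq_zero hw, hψ0] at h1
      refine Submodule.subset_span (tangentConeAt_mono ?_ h1)
      rintro _ ⟨z, hz, rfl⟩
      exact hz
  · -- the second order Taylor estimate for `f` at `ξ`
    have hd1 : DifferentiableAt ℝ (fderiv ℝ f) ξ :=
      (hfξ.fderiv_right (m := 2) (by norm_num)).differentiableAt (by norm_num)
    obtain ⟨C, hC⟩ := hd1.isBigO_sub.bound
    obtain ⟨δ, hδ, hδC⟩ := Metric.eventually_nhds_iff_ball.1 (hC.and (hU.mem_nhds hξU))
    refine ⟨|C| / |a|, ?_⟩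
    filter_upwards [Metric.ball_mem_nhds ξ hδ] with y hy hyΘ
    have hsub : Metric.closedBall ξ ‖y - ξ‖ ⊆ Metric.ball ξ δ := by
      intro z hz
      rw [Metric.mem_closedBall] at hz
      rw [Metric.mem_ball, dist_eq_norm] at hy
      exact Metric.mem_ball.2 (hz.trans_lt hy)
    have hC0 : ∀ z ∈ Metric.closedBall ξ ‖y - ξ‖,
        ‖fderiv ℝ f z - fderiv ℝ f ξ‖ ≤ |C| * ‖y - ξ‖ := by
      intro z hz
      refine (hδC z (hsub hz)).1.trans ?_
      rw [Metric.mem_closedBall, dist_eq_norm] at hz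
      exact mul_le_mul (le_abs_self C) hz (norm_nonneg _) (abs_nonneg _)
    have hyU : y ∈ Metric.closedBall ξ ‖y - ξ‖ := by rw [Metric.mem_closedBall, dist_eq_norm]
    have h1 := (convex_closedBall ξ ‖y - ξ‖).norm_image_sub_le_of_norm_hasFDerivWithin_le'
      (fun z hz => ((hf.contDiffAt (hU.mem_nhds (hδC z (hsub hz)).2)).differentiableAt
        (by norm_num)).hasFDerivAt.hasFDerivWithinAt) hC0
      (Metric.mem_closedBall_self (norm_nonneg _)) hyU
    rw [(hzero y (hδC y (hsub hyU)).2).1 hyΘ, (hzero ξ hξU).1 hξ, hfa, sub_zero, zero_sub,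
      norm_neg, Real.norm_eq_abs, abs_mul] at h1
    rw [div_mul_eq_mul_div, le_div_iff₀ (abs_pos.2 ha)]
    linarith

/-- Near each of its points, a `C³` hypersurface has a `C²` unit normal field, the normalized gradient
of a defining function. -/
lemma IsHypersurface.exists_isLocalGraph (hΘ : IsHypersurface 3 Θ) {ξ : Rd d} (hξ : ξ ∈ Θ) :
    ∃ V : Set (Rd d), ∃ n : Rd d → Rd d, IsOpen V ∧ ξ ∈ V ∧ ContDiffOn ℝ 2 n V ∧
      ∀ x ∈ Θ ∩ V, ∃ ψ, IsLocalGraph Θ x (n x) ψ := by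
  obtain ⟨U, hU, hξU, f, hf, hf', hfU⟩ := hΘ ξ hξ
  obtain ⟨J, hJ⟩ := exists_riesz d
  have hf3 : ContDiffOn ℝ 3 f U := hf
  have hJ0 : ∀ x ∈ U, J (fderiv ℝ f x) ≠ 0 := by
    intro x hx h0
    refine hf' x hx (ContinuousLinearMap.ext fun w => ?_)
    rw [← hJ, h0, inner_zero_left]
    rfl
  have hJc : ContDiffOn ℝ 2 (fun x => J (fderiv ℝ f x)) U :=
    J.contDiff.comp_contDiffOn (hf3.fderiv_of_isOpen hU (by norm_num))
  refine ⟨U, fun x => ‖J (fderiv ℝ f x)‖⁻¹ • J (fderiv ℝ f x), hU, hξU, ?_, ?_⟩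
  · exact ((hJc.norm ℝ hJ0).inv fun x hx => norm_ne_zero_iff.2 (hJ0 x hx)).smul hJc
  · rintro x ⟨hxΘ, hx⟩
    have h0 := norm_ne_zero_iff.2 (hJ0 x hx)
    refine exists_isLocalGraph_of_fderiv hU hx hxΘ hf3 hfU ?_ h0 fun w => ?_
    · rw [norm_smul, norm_inv, norm_norm, inv_mul_cancel₀ h0]
    · rw [real_inner_smul_left, hJ, mul_inv_cancel_left₀ h0]

end Local

/-! ### Normal segments and the closest point projection -/

section Reach

variable {d : ℕ} {Θ : Set (Rd d)} {ε : ℝ} {ξ ν : Rd d} {ψ : Rd d → Rd d}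

lemma IsLocalGraph.neg (g : IsLocalGraph Θ ξ ν ψ) : IsLocalGraph Θ ξ (-ν) ψ := by
  have hP : projPerp (-ν) = projPerp ν := by
    refine ContinuousLinearMap.ext fun w => ?_
    simp [projPerp_apply]
  refine ⟨by rw [norm_neg, g.norm_eq], ?_, g.contDiffAt, g.map_zero, ?_, g.eventually_mem, ?_, ?_,
    ?_⟩
  · rw [g.tangentSpaceAt_eq]
    ext w
    simp only [Submodule.mem_orthogonal_singleton_iff_inner_right, inner_neg_left, neg_eq_zero]
  · rw [hP]; exact g.hasFDerivAt
  · rw [hP]; exact g.eventually_proj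
  · rw [hP]; exact g.map_projPerp
  · simpa only [inner_neg_left, abs_neg] using g.inner_le

lemma IsLocalGraph.isUnitNormal (g : IsLocalGraph Θ ξ ν ψ) : IsUnitNormal Θ ξ ν := by
  refine ⟨g.norm_eq, fun v hv => ?_⟩
  rw [g.tangentSpaceAt_eq, Submodule.mem_orthogonal_singleton_iff_inner_right] at hv
  exact hv

lemma IsLocalGraph.eq_or_eq_neg (g : IsLocalGraph Θ ξ ν ψ) {ν' : Rd d}
    (h : IsUnitNormal Θ ξ ν') : ν' = ν ∨ ν' = -ν := by
  have h1 : inner ℝ ν' (projPerp ν ν') = 0 := by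
    apply h.2
    rw [g.tangentSpaceAt_eq, Submodule.mem_orthogonal_singleton_iff_inner_right]
    exact inner_projPerp g.norm_eq _
  have h2 := eq_smul_of_inner_projPerp_eq_zero g.norm_eq h1
  have h3 : |inner ℝ ν ν'| = 1 := by
    have := congrArg norm h2
    rwa [norm_smul, g.norm_eq, h.1, mul_one, Real.norm_eq_abs, eq_comm] at this
  rcases eq_or_eq_neg_of_abs_eq h3 with h4 | h4
  · left; rw [h2, h4, one_smul]
  · right; rw [h2, h4, neg_smul, one_smul]

lemma IsLocalGraph.mem (g : IsLocalGraph Θ ξ ν ψ) : ξ ∈ Θ := by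
  have := g.eventually_mem.self_of_nhds
  rwa [g.map_zero] at this

/-- The segment from a point to a closest point of `Θ` is normal to `Θ`. -/
lemma IsLocalGraph.eq_add_smul (g : IsLocalGraph Θ ξ ν ψ) {x : Rd d}
    (hx : IsClosestPoint Θ x ξ) : x = ξ + inner ℝ ν (x - ξ) • ν := by
  have hmin : IsLocalMin (fun w => ‖x - ψ w‖ ^ 2) 0 := by
    filter_upwards [g.eventually_mem] with w hw
    have h1 := Metric.infDist_le_dist_of_mem (x := x) hw
    rw [← hx.2, dist_eq_norm, dist_eq_norm] at h1
    rw [g.map_zero]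
    gcongr
  have hd : HasFDerivAt (fun w => ‖x - ψ w‖ ^ 2)
      (2 • (innerSL ℝ (x - ψ 0)).comp (0 - projPerp ν)) 0 :=
    ((hasFDerivAt_const x (0 : Rd d)).sub g.hasFDerivAt).norm_sq
  have h0 := hmin.hasFDerivAt_eq_zero hd
  have h1 := congrArg (fun l : Rd d →L[ℝ] ℝ => l (projPerp ν (x - ξ))) h0
  have hPP : projPerp ν (projPerp ν (x - ξ)) = projPerp ν (x - ξ) :=
    projPerp_of_inner_eq_zero (inner_projPerp g.norm_eq _)
  have h2 : inner ℝ (x - ξ) (projPerp ν (x - ξ)) = 0 := by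
    rw [g.map_zero] at h1
    generalize projPerp ν (x - ξ) = v at h1 hPP ⊢
    generalize x - ξ = z at h1 ⊢
    simpa [hPP] using h1
  exact sub_eq_iff_eq_add'.1 (eq_smul_of_inner_projPerp_eq_zero g.norm_eq h2)

/-- A small ball tangent to `Θ` at `ξ` does not meet `Θ`. -/
lemma IsLocalGraph.exists_infDist_eq (g : IsLocalGraph Θ ξ ν ψ) {t : ℝ} (ht : 0 < t) :
    ∃ r, 0 < r ∧ r ≤ t ∧ Metric.infDist (ξ + r • ν) Θ = r := by
  obtain ⟨K, hK⟩ := g.inner_le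
  obtain ⟨δ, hδ, hδK⟩ := Metric.eventually_nhds_iff_ball.1 hK
  set r := min t (min (δ / 2) (1 / (2 * (|K| + 1)))) with hr
  have hr0 : 0 < r := lt_min ht (lt_min (by positivity) (by positivity))
  have hr1 : r ≤ δ / 2 := (min_le_right _ _).trans (min_le_left _ _)
  have hr2 : r * (2 * (|K| + 1)) ≤ 1 := by
    rw [← le_div_iff₀ (by positivity)]
    exact (min_le_right _ _).trans (min_le_right _ _)
  have hrν : ‖r • ν‖ = r := by rw [norm_smul, g.norm_eq, Real.norm_of_nonneg hr0.le, mul_one]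
  refine ⟨r, hr0, min_le_left _ _, le_antisymm ?_ ?_⟩
  · refine (Metric.infDist_le_dist_of_mem g.mem).trans ?_
    rw [dist_eq_norm, add_sub_cancel_left, hrν]
  · rw [Metric.le_infDist ⟨ξ, g.mem⟩]
    intro y hy
    rw [dist_eq_norm]
    by_cases hyδ : y ∈ Metric.ball ξ δ
    · have h1 := hδK y hyδ hy
      have h2 : ‖ξ + r • ν - y‖ ^ 2 = r ^ 2 - 2 * r * inner ℝ ν (y - ξ) + ‖y - ξ‖ ^ 2 := by
        rw [show ξ + r • ν - y = r • ν - (y - ξ) by abel, norm_sub_sq_real, hrν,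
          real_inner_smul_left]
        ring
      refine (abs_le_of_sq_le_sq' ?_ (norm_nonneg _)).2
      rw [h2]
      have h3 : r * inner ℝ ν (y - ξ) ≤ r * (|K| * ‖y - ξ‖ ^ 2) := by
        gcongr
        exact (le_abs_self _).trans (h1.trans (by gcongr; exact le_abs_self K))
      nlinarith [sq_nonneg ‖y - ξ‖, mul_le_mul_of_nonneg_right hr2 (sq_nonneg ‖y - ξ‖),
        mul_nonneg hr0.le (sq_nonneg ‖y - ξ‖)]
    · rw [Metric.mem_ball, not_lt, dist_eq_norm] at hyδ
      have h1 : ‖y - ξ‖ ≤ ‖ξ + r • ν - y‖ + ‖r • ν‖ := by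
        rw [show y - ξ = -(ξ + r • ν - y) + r • ν by abel]
        refine (norm_add_le _ _).trans ?_
        rw [norm_neg]
      rw [hrν] at h1
      linarith

theorem IsLocalGraph.infDist_add_smul_of_nonneg (g : IsLocalGraph Θ ξ ν ψ) (hε : 0 < ε)
    (h : HasUniqueClosestPoints Θ ε) {t : ℝ} (h0 : 0 ≤ t) (ht : t < ε) :
    Metric.infDist (ξ + t • ν) Θ = t := by
  rcases h0.eq_or_lt with rfl | h0
  · rw [zero_smul, add_zero]
    exact Metric.infDist_zero_of_mem g.mem
  · obtain ⟨r, hr, hrt, hrd⟩ := g.exists_infDist_eq h0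
    exact h.infDist_add_smul hε g.mem g.norm_eq hr hrd hrt ht

theorem IsLocalGraph.infDist_add_smul (g : IsLocalGraph Θ ξ ν ψ) (hε : 0 < ε)
    (h : HasUniqueClosestPoints Θ ε) {t : ℝ} (ht : |t| < ε) :
    Metric.infDist (ξ + t • ν) Θ = |t| := by
  rcases le_total 0 t with h0 | h0
  · rw [abs_of_nonneg h0] at ht ⊢
    exact g.infDist_add_smul_of_nonneg hε h h0 ht
  · rw [abs_of_nonpos h0] at ht ⊢
    have := g.neg.infDist_add_smul_of_nonneg hε h (neg_nonneg.2 h0) ht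
    rwa [smul_neg, neg_smul, neg_neg] at this

lemma IsLocalGraph.add_smul_mem_thickening (g : IsLocalGraph Θ ξ ν ψ) {t : ℝ} (ht : |t| < ε) :
    ξ + t • ν ∈ Metric.thickening ε Θ := by
  refine Metric.mem_thickening_iff.2 ⟨ξ, g.mem, ?_⟩
  rwa [dist_eq_norm, add_sub_cancel_left, norm_smul, g.norm_eq, mul_one, Real.norm_eq_abs]

theorem IsLocalGraph.closestPoint_add_smul (g : IsLocalGraph Θ ξ ν ψ) (hε : 0 < ε)
    (h : HasUniqueClosestPoints Θ ε) {t : ℝ} (ht : |t| < ε) :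
    closestPoint Θ (ξ + t • ν) = ξ := by
  refine h.closestPoint_eq (g.add_smul_mem_thickening ht) ⟨g.mem, ?_⟩
  rw [g.infDist_add_smul hε h ht, dist_eq_norm, add_sub_cancel_left, norm_smul, g.norm_eq, mul_one,
    Real.norm_eq_abs]

/-- The hypersurface has positive reach: `Θ` lies outside the balls of radius `ε / 2` that are
tangent to it at `ξ`. -/
lemma IsLocalGraph.abs_inner_le (g : IsLocalGraph Θ ξ ν ψ) (hε : 0 < ε)
    (h : HasUniqueClosestPoints Θ ε) {y : Rd d} (hy : y ∈ Θ) :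
    ε * |inner ℝ ν (y - ξ)| ≤ ‖y - ξ‖ ^ 2 := by
  have key : ∀ {ν}, IsLocalGraph Θ ξ ν ψ → ε * inner ℝ ν (y - ξ) ≤ ‖y - ξ‖ ^ 2 := by
    intro ν g
    have h1 := Metric.infDist_le_dist_of_mem (x := ξ + (ε / 2) • ν) hy
    rw [g.infDist_add_smul_of_nonneg hε h (by positivity) (by linarith), dist_eq_norm,
      show ξ + (ε / 2) • ν - y = (ε / 2) • ν - (y - ξ) by abel] at h1
    have h2 : (ε / 2) ^ 2 ≤ ‖(ε / 2) • ν - (y - ξ)‖ ^ 2 := by gcongr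
    rw [norm_sub_sq_real, norm_smul, g.norm_eq, real_inner_smul_left,
      Real.norm_of_nonneg (by positivity)] at h2
    nlinarith
  rcases abs_cases (inner ℝ ν (y - ξ)) with h1 | h1 <;> rw [h1.1]
  · exact key g
  · have := key g.neg
    rwa [inner_neg_left] at this

/-- The closest point projection is Lipschitz near `Θ`. -/
theorem HasUniqueClosestPoints.norm_closestPoint_sub_le (hε : 0 < ε)
    (h : HasUniqueClosestPoints Θ ε) (hΘ : IsHypersurface 3 Θ) {x y : Rd d}
    (hx : x ∈ Metric.thickening (ε / 4) Θ) (hy : y ∈ Metric.thickening (ε / 4) Θ) :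
    ‖closestPoint Θ x - closestPoint Θ y‖ ≤ 2 * ‖x - y‖ := by
  have key : ∀ x ∈ Metric.thickening (ε / 4) Θ, ∀ q ∈ Θ,
      inner ℝ (x - closestPoint Θ x) (q - closestPoint Θ x) ≤ ‖q - closestPoint Θ x‖ ^ 2 / 4 := by
    intro x hx q hq
    have hcl := h.isClosestPoint_closestPoint (Metric.thickening_mono (by linarith) Θ hx)
    have hlt := (infDist_lt_of_mem_thickening hx).2
    rw [← hcl.2, dist_eq_norm] at hlt
    set p := closestPoint Θ x
    obtain ⟨V, n, -, hpV, -, hg⟩ := hΘ.exists_isLocalGraph hcl.1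
    obtain ⟨ψ, g⟩ := hg p ⟨hcl.1, hpV⟩
    have h1 := g.eq_add_smul hcl
    have h2 : x - p = inner ℝ (n p) (x - p) • n p := sub_eq_iff_eq_add'.2 h1
    have h3 := g.abs_inner_le hε h hq
    have h4 : |inner ℝ (n p) (x - p)| ≤ ε / 4 := by
      have := congrArg norm h2
      rw [norm_smul, g.norm_eq, mul_one, Real.norm_eq_abs] at this
      linarith
    rw [h2, real_inner_smul_left]
    refine (le_abs_self _).trans ?_
    rw [abs_mul]
    calc _ ≤ ε / 4 * |inner ℝ (n p) (q - p)| := by gcongr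
      _ ≤ _ := by linarith
  have hpx := (h.isClosestPoint_closestPoint (Metric.thickening_mono (by linarith) Θ hx)).1
  have hpy := (h.isClosestPoint_closestPoint (Metric.thickening_mono (by linarith) Θ hy)).1
  have h1 := key x hx _ hpy
  have h2 := key y hy _ hpx
  set p := closestPoint Θ x
  set q := closestPoint Θ y
  have h3 : ‖p - q‖ ^ 2 = inner ℝ (x - y) (p - q) + inner ℝ (x - p) (q - p)
      + inner ℝ (y - q) (p - q) := by
    rw [← real_inner_self_eq_norm_sq, ← neg_sub p q, inner_neg_right, ← sub_eq_add_neg,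
      ← inner_sub_left, ← inner_add_left]
    congr 1
    abel
  have h4 : inner ℝ (x - y) (p - q) ≤ ‖x - y‖ * ‖p - q‖ := real_inner_le_norm _ _
  rw [norm_sub_rev q p] at h1
  by_contra! hlt
  have h5 : 0 < ‖p - q‖ := lt_of_le_of_lt (by positivity) hlt
  nlinarith

end Reach

/-! ### One-sided limits of the drift -/

section Alpha

variable {d : ℕ} {Θ : Set (Rd d)} {ε : ℝ} {ξ ν : Rd d} {ψ : Rd d → Rd d}

lemma intrinsicDist_le_of_segment {A : Set (Rd d)} {s t : ℝ}
    (hA : ∀ r ∈ segment ℝ s t, ξ + r • ν ∈ A) (hν : ‖ν‖ = 1) :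
    intrinsicDist A (ξ + s • ν) (ξ + t • ν) ≤ edist s t := by
  set γ : ℝ → Rd d := fun k => ξ + (s + k * (t - s)) • ν with hγ
  have hlip : LipschitzWith (nndist s t) γ := by
    refine LipschitzWith.of_dist_le_mul fun k l => le_of_eq ?_
    rw [hγ, dist_eq_norm, show ξ + (s + k * (t - s)) • ν - (ξ + (s + l * (t - s)) • ν) =
      ((k - l) * (t - s)) • ν by module, norm_smul, hν, mul_one, norm_mul, coe_nndist, dist_eq_norm,
      dist_eq_norm, norm_sub_rev s t, mul_comm]
  have h0 : γ 0 = ξ + s • ν := by simp [hγ]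
  have h1 : γ 1 = ξ + t • ν := by simp [hγ]
  have hmaps : MapsTo γ (Icc 0 1) A := by
    intro k hk
    refine hA _ ?_
    rw [segment_eq_image']
    exact ⟨k, hk, rfl⟩
  refine (iInf₂_le γ ⟨hlip.continuous.continuousOn, hmaps, h0, h1⟩).trans ?_
  have h2 := (hlip.lipschitzOnWith (s := univ)).comp_eVariationOn_le (g := (id : ℝ → ℝ))
    (s := Icc 0 1) (mapsTo_univ _ _)
  have h3 : eVariationOn (id : ℝ → ℝ) (Icc 0 1) ≤ 1 := by
    have := (monotone_id.monotoneOn (Icc (0 : ℝ) 1)).eVariationOn_eq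
      (left_mem_Icc.2 zero_le_one) (right_mem_Icc.2 zero_le_one)
    rw [inter_self] at this
    simp [this]
  refine h2.trans ?_
  rw [edist_nndist]
  calc _ ≤ (nndist s t : ℝ≥0∞) * 1 := by gcongr
    _ = _ := mul_one _

/-- A function that is intrinsic Lipschitz off `Θ` has one-sided limits at `Θ` along normals. -/
lemma IsLocalGraph.exists_tendsto (g : IsLocalGraph Θ ξ ν ψ) (hε : 0 < ε)
    (h : HasUniqueClosestPoints Θ ε) {μ : Rd d → Rd d} (hμ : IntrinsicLipschitzOn μ Θᶜ) :
    ∃ m, Tendsto (fun k : ℝ => μ (ξ + k • ν)) (𝓝[>] 0) (𝓝 m) := by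
  obtain ⟨L, hL⟩ := hμ
  have hmem : ∀ k ∈ Ioo (0 : ℝ) ε, ξ + k • ν ∈ Θᶜ := by
    intro k hk hkΘ
    have h1 := g.infDist_add_smul_of_nonneg hε h hk.1.le hk.2
    rw [Metric.infDist_zero_of_mem hkΘ] at h1
    exact hk.1.ne h1
  have hlip : LipschitzOnWith L (fun k : ℝ => μ (ξ + k • ν)) (Ioo 0 ε) := by
    intro s hs t ht
    refine (hL _ (hmem s hs) _ (hmem t ht)).trans ?_
    gcongr
    exact intrinsicDist_le_of_segment
      (fun r hr => hmem r ((convex_Ioo 0 ε).segment_subset hs ht hr)) g.norm_eq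
  obtain ⟨G, hG, hEq⟩ := hlip.extend_finite_dimension
  refine ⟨G 0, (hG.continuous.tendsto 0 |>.mono_left nhdsWithin_le_nhds).congr' ?_⟩
  filter_upwards [Ioo_mem_nhdsGT hε] with k hk
  exact (hEq hk).symm

lemma IsLocalGraph.alpha_neg (g : IsLocalGraph Θ ξ ν ψ) (hε : 0 < ε)
    (h : HasUniqueClosestPoints Θ ε) {μ : Rd d → Rd d} (hμ : IntrinsicLipschitzOn μ Θᶜ)
    (σ : Rd d → Matrix (Fin d) (Fin d) ℝ) :
    alpha μ σ (-ν) ξ = -alpha μ σ ν ξ := by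
  obtain ⟨m₁, h₁⟩ := g.exists_tendsto hε h hμ
  obtain ⟨m₂, h₂⟩ := g.neg.exists_tendsto hε h hμ
  set C : ℝ := (2 * inner ℝ ν (Matrix.toEuclideanLin (σ ξ * (σ ξ).transpose) ν))⁻¹ with hC
  have e₁ : alpha μ σ ν ξ = C • (m₂ - m₁) := by
    refine Tendsto.limUnder_eq ?_
    refine Tendsto.const_smul (Tendsto.sub (h₂.congr fun k => ?_) h₁) C
    rw [smul_neg, ← sub_eq_add_neg]
  have e₂ : alpha μ σ (-ν) ξ = C • (m₁ - m₂) := by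
    refine Tendsto.limUnder_eq ?_
    simp only [map_neg, inner_neg_neg, ← hC]
    refine Tendsto.const_smul (Tendsto.sub (h₁.congr fun k => ?_) h₂) C
    rw [smul_neg, sub_neg_eq_add]
  rw [e₁, e₂, ← smul_neg, neg_sub]

/-- The displacement `φ̃ α` does not depend on the choice of the unit normal vector. -/
lemma IsLocalGraph.phiTilde_smul_alpha (g : IsLocalGraph Θ ξ ν ψ) (hε : 0 < ε)
    (h : HasUniqueClosestPoints Θ ε) {μ : Rd d → Rd d} (hμ : IntrinsicLipschitzOn μ Θᶜ)
    (σ : Rd d → Matrix (Fin d) (Fin d) ℝ) (c : ℝ) (x : Rd d) :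
    phiTilde c ξ (unitNormal Θ ξ) x • alpha μ σ (unitNormal Θ ξ) ξ =
      phiTilde c ξ ν x • alpha μ σ ν ξ := by
  have h1 : IsUnitNormal Θ ξ (unitNormal Θ ξ) := Classical.epsilon_spec ⟨ν, g.isUnitNormal⟩
  rcases g.eq_or_eq_neg h1 with h2 | h2
  · rw [h2]
  · rw [h2, g.alpha_neg hε h hμ σ, phiTilde, phiTilde, inner_neg_right]
    simp only [neg_mul, neg_smul, smul_neg, neg_neg]

end Alpha

/-! ### The radial profile of the transform -/

/-- The function `t ↦ t |t| φ(|t| / c)` of the signed distance `t`. -/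
noncomputable def profile (c t : ℝ) : ℝ := t * |t| * bump (|t| / c)

section Profile

variable {c : ℝ}

lemma bump_div_eq (hc : 0 < c) (t : ℝ) : bump (|t| / c) = max 0 (1 - t ^ 2 / c ^ 2) ^ 3 := by
  have h1 : t ^ 2 / c ^ 2 = (|t| / c) ^ 2 := by rw [div_pow, sq_abs]
  have h0 : 0 ≤ |t| / c := by positivity
  rw [h1, bump, abs_of_nonneg h0]
  split_ifs with h
  · rw [max_eq_right (by nlinarith)]
    ring
  · rw [max_eq_left (by nlinarith)]
    norm_num

lemma hasDerivAt_mul_abs (t : ℝ) : HasDerivAt (fun t : ℝ => t * |t|) (2 * |t|) t := by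
  rcases lt_trichotomy t 0 with h | rfl | h
  · have h1 : HasDerivAt (fun t : ℝ => -(t * t)) (-(1 * t + t * 1)) t :=
      ((hasDerivAt_id t).mul (hasDerivAt_id t)).neg
    rw [abs_of_neg h]
    refine (h1.congr_of_eventuallyEq ?_).congr_deriv (by ring)
    filter_upwards [gt_mem_nhds h] with s hs
    rw [abs_of_neg hs]; ring
  · rw [abs_zero, mul_zero, hasDerivAt_iff_isLittleO_nhds_zero]
    simp only [zero_add, abs_zero, mul_zero, sub_zero, smul_zero]
    refine Asymptotics.isLittleO_of_tendsto (by rintro x rfl; simp) ?_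
    have : Tendsto (fun x : ℝ => |x|) (𝓝 0) (𝓝 0) := by
      simpa using continuous_abs.tendsto (0 : ℝ)
    refine squeeze_zero_norm (fun x => ?_) this
    rw [norm_div, norm_mul, Real.norm_eq_abs, Real.norm_eq_abs, abs_abs]
    exact div_le_of_le_mul₀ (abs_nonneg _) (abs_nonneg _) le_rfl
  · have h1 : HasDerivAt (fun t : ℝ => t * t) (1 * t + t * 1) t :=
      (hasDerivAt_id t).mul (hasDerivAt_id t)
    rw [abs_of_pos h]
    refine (h1.congr_of_eventuallyEq ?_).congr_deriv (by ring)
    filter_upwards [lt_mem_nhds h] with s hs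
    rw [abs_of_pos hs]

lemma hasDerivAt_max_zero_pow_three (t : ℝ) :
    HasDerivAt (fun t : ℝ => max 0 t ^ 3) (3 * max 0 t ^ 2) t := by
  have h : (fun t : ℝ => max 0 t ^ 3) = fun t : ℝ => (t ^ 3 + t * |t| * t) / 2 := by
    funext t
    rcases le_total 0 t with h | h
    · rw [max_eq_right h, abs_of_nonneg h]; ring
    · rw [max_eq_left h, abs_of_nonpos h]; ring
  rw [h]
  refine ((((hasDerivAt_pow 3 t).add ((hasDerivAt_mul_abs t).mul (hasDerivAt_id t))).div_const
    2).congr_deriv ?_)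
  rcases le_total 0 t with h | h
  · rw [max_eq_right h, abs_of_nonneg h]; simp; ring
  · rw [max_eq_left h, abs_of_nonpos h]; simp; ring

lemma hasDerivAt_profile (hc : 0 < c) (t : ℝ) : HasDerivAt (profile c)
    (2 * |t| * max 0 (1 - t ^ 2 / c ^ 2) ^ 3 +
      t * |t| * (3 * max 0 (1 - t ^ 2 / c ^ 2) ^ 2 * (-(2 * t / c ^ 2)))) t := by
  have h : profile c = fun t => t * |t| * max 0 (1 - t ^ 2 / c ^ 2) ^ 3 := by
    funext t
    rw [profile, bump_div_eq hc]
  rw [h]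
  refine (hasDerivAt_mul_abs t).mul ((hasDerivAt_max_zero_pow_three _).comp t ?_)
  have := ((hasDerivAt_pow 2 t).div_const (c ^ 2)).const_sub 1
  simpa using this

lemma contDiff_profile (hc : 0 < c) : ContDiff ℝ 1 (profile c) := by
  rw [contDiff_one_iff_deriv]
  refine ⟨fun t => (hasDerivAt_profile hc t).differentiableAt, ?_⟩
  rw [funext fun t => (hasDerivAt_profile hc t).deriv]
  fun_prop

lemma profile_eq_zero (hc : 0 < c) {t : ℝ} (h : c ≤ |t|) : profile c t = 0 := by
  rw [profile, bump_div_eq hc, max_eq_left]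
  · norm_num
  · rw [sub_nonpos, one_le_div (by positivity), ← sq_abs t]
    gcongr

lemma max_zero_le_one (hc : 0 < c) (t : ℝ) : max 0 (1 - t ^ 2 / c ^ 2) ≤ 1 :=
  max_le zero_le_one (by have : 0 ≤ t ^ 2 / c ^ 2 := by positivity
                         linarith)

lemma abs_profile_le (hc : 0 < c) (t : ℝ) : |profile c t| ≤ c ^ 2 := by
  rcases le_total c |t| with h | h
  · rw [profile_eq_zero hc h, abs_zero]
    positivity
  · have h0 : 0 ≤ max 0 (1 - t ^ 2 / c ^ 2) ^ 3 := pow_nonneg (le_max_left _ _) 3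
    rw [profile, bump_div_eq hc, abs_mul, abs_mul, abs_abs, abs_of_nonneg h0]
    have : max 0 (1 - t ^ 2 / c ^ 2) ^ 3 ≤ 1 := pow_le_one₀ (le_max_left _ _) (max_zero_le_one hc t)
    calc _ ≤ c * c * 1 := by gcongr
      _ = c ^ 2 := by ring

lemma abs_deriv_profile_le (hc : 0 < c) (t : ℝ) : |deriv (profile c) t| ≤ 8 * c := by
  rw [(hasDerivAt_profile hc t).deriv]
  rcases le_total c |t| with h | h
  · rw [max_eq_left]
    · norm_num
      positivity
    · rw [sub_nonpos, one_le_div (by positivity), ← sq_abs t]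
      gcongr
  · set m := max 0 (1 - t ^ 2 / c ^ 2) with hm
    have hm0 : 0 ≤ m := le_max_left _ _
    have hm1 : m ≤ 1 := max_zero_le_one hc t
    have h2 : m ^ 2 ≤ 1 := pow_le_one₀ hm0 hm1
    have h3 : m ^ 3 ≤ 1 := pow_le_one₀ hm0 hm1
    refine (abs_add_le _ _).trans ?_
    simp only [abs_mul, abs_neg, abs_abs, abs_div, abs_pow, abs_of_nonneg hm0, abs_of_pos hc,
      abs_two, abs_of_pos (three_pos (α := ℝ))]
    calc _ ≤ 2 * c * 1 + c * c * (3 * 1 * (2 * c / c ^ 2)) := by gcongr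
      _ = 8 * c := by field_simp; norm_num

end Profile

/-! ### Normal coordinates -/

section Coordinates

variable {d : ℕ} {Θ : Set (Rd d)} {ε : ℝ} {ξ : Rd d} {ψ : Rd d → Rd d}

/-- A map that does not contract at `0` has an injective derivative there. -/
lemma injective_of_norm_le {F : Rd d → Rd d} {F' : Rd d →L[ℝ] Rd d} (hF : HasFDerivAt F F' 0)
    {C : ℝ} (h : ∀ᶠ w in 𝓝 (0 : Rd d), ‖w‖ ≤ C * ‖F w - F 0‖) : Function.Injective F' := by
  rw [injective_iff_map_eq_zero]
  intro w hw
  have hl : HasDerivAt (fun s : ℝ => s • w) w 0 := by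
    simpa using (hasDerivAt_id (0 : ℝ)).smul_const w
  have hF0 : HasFDerivAt F F' ((0 : ℝ) • w) := by rwa [zero_smul]
  have h1 := hF0.comp_hasDerivAt (0 : ℝ) hl
  rw [hw, hasDerivAt_iff_isLittleO] at h1
  have h2 : (fun s : ℝ => s • w) =O[𝓝 0] fun s : ℝ => F (s • w) - F 0 := by
    refine Asymptotics.IsBigO.of_bound C ?_
    have : Tendsto (fun s : ℝ => s • w) (𝓝 0) (𝓝 0) := by
      have := hl.continuousAt.tendsto
      rwa [zero_smul] at this
    exact this.eventually h
  have h3 : (fun s : ℝ => s • w) =o[𝓝 0] fun s : ℝ => s := by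
    refine h2.trans_isLittleO ?_
    simpa using h1
  have h4 : HasDerivAt (fun s : ℝ => s • w) 0 0 := by
    rw [hasDerivAt_iff_isLittleO]
    simpa using h3
  exact hl.unique h4

lemma abs_le_abs_abs_add_sub_abs {t τ : ℝ} (h : t = 0 ∨ |τ| < |t|) :
    |τ| ≤ |(|t + τ| - |t|)| := by
  rcases h with rfl | h
  · rw [zero_add, abs_zero, sub_zero, abs_abs]
  · rcases le_total 0 t with h0 | h0
    · rw [abs_of_nonneg h0] at h
      rw [abs_of_nonneg h0, abs_of_pos (show 0 < t + τ by linarith [(abs_lt.1 h).1]),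
        add_sub_cancel_left]
    · rw [abs_of_nonpos h0] at h
      rw [abs_of_nonpos h0, abs_of_neg (show t + τ < 0 by linarith [(abs_lt.1 h).2]),
        show -(t + τ) - -t = -τ by ring, abs_neg]

/-- Normal coordinates near a point `x₀` close to `Θ`: every `x` near `x₀` is the point at signed
distance `t₀ + ⟪ν, W x⟫` from `ψ (W x)` on the normal to `Θ` there. Since the closest point
projection and the distance to `Θ` are Lipschitz, the coordinate map `w ↦ x` cannot contract, so that
the inverse function theorem provides `W`. -/
theorem IsLocalGraph.exists_coordinates (hε : 0 < ε)
    (h : HasUniqueClosestPoints Θ ε) (hΘ : IsHypersurface 3 Θ) {V : Set (Rd d)} {n : Rd d → Rd d}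
    (hV : IsOpen V) (hξV : ξ ∈ V) (hn : ContDiffOn ℝ 2 n V)
    (hg : ∀ x ∈ Θ ∩ V, ∃ ψ, IsLocalGraph Θ x (n x) ψ)
    (g : IsLocalGraph Θ ξ (n ξ) ψ) {t₀ : ℝ} (ht₀ : |t₀| < ε / 4) :
    ∃ W : Rd d → Rd d, ContDiffAt ℝ 2 W (ξ + t₀ • n ξ) ∧ W (ξ + t₀ • n ξ) = 0 ∧
      ∀ᶠ x in 𝓝 (ξ + t₀ • n ξ), ψ (W x) ∈ Θ ∩ V ∧ closestPoint Θ x = ψ (W x) ∧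
        x = ψ (W x) + (t₀ + inner ℝ (n ξ) (W x)) • n (ψ (W x)) ∧
        ‖projPerp (n ξ) (W x)‖ ≤ 2 * ‖x - (ξ + t₀ • n ξ)‖ ∧
        |inner ℝ (n ξ) (W x)| ≤ ‖x - (ξ + t₀ • n ξ)‖ := by
  set ν := n ξ with hν
  set x₀ := ξ + t₀ • ν with hx₀
  set F : Rd d → Rd d := fun w => ψ w + (t₀ + inner ℝ ν w) • n (ψ w) with hF
  have hF0 : F 0 = x₀ := by simp [hF, g.map_zero, hx₀, ← hν]
  have hFc : ContDiffAt ℝ 2 F 0 := by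
    have h1 : ContDiffAt ℝ 2 ψ 0 := g.contDiffAt.of_le (by norm_num)
    have h2 : ContDiffAt ℝ 2 (fun w => n (ψ w)) 0 := by
      refine ContDiffAt.comp (0 : Rd d) ?_ h1
      rw [g.map_zero]
      exact hn.contDiffAt (hV.mem_nhds hξV)
    have h3 : ContDiffAt ℝ 2 (fun w : Rd d => t₀ + inner ℝ ν w) 0 :=
      contDiffAt_const.add (contDiffAt_const.inner ℝ contDiffAt_id)
    exact h1.add (h3.smul h2)
  have hτ : Tendsto (fun w : Rd d => inner ℝ ν w) (𝓝 0) (𝓝 0) := by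
    have : Continuous fun w : Rd d => inner ℝ ν w := by fun_prop
    simpa using this.tendsto 0
  have hmem : ∀ᶠ w in 𝓝 (0 : Rd d), ψ w ∈ Θ ∩ V := by
    have h1 : ∀ᶠ w in 𝓝 (0 : Rd d), ψ w ∈ V := by
      refine g.contDiffAt.continuousAt.eventually_mem ?_
      rw [g.map_zero]
      exact hV.mem_nhds hξV
    exact g.eventually_mem.and h1
  have hsmall : ∀ᶠ w in 𝓝 (0 : Rd d), |t₀ + inner ℝ ν w| < ε / 4 := by
    have h1 := ((tendsto_const_nhds (x := t₀)).add hτ).abs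
    rw [add_zero] at h1
    exact h1.eventually (gt_mem_nhds ht₀)
  have hpF : ∀ᶠ w in 𝓝 (0 : Rd d), closestPoint Θ (F w) = ψ w ∧
      Metric.infDist (F w) Θ = |t₀ + inner ℝ ν w| ∧ F w ∈ Metric.thickening (ε / 4) Θ := by
    filter_upwards [hmem, hsmall] with w hw1 hw2
    obtain ⟨ψ', g'⟩ := hg _ hw1
    exact ⟨g'.closestPoint_add_smul hε h (by linarith),
      g'.infDist_add_smul hε h (by linarith), g'.add_smul_mem_thickening hw2⟩
  have hB1 : ∀ᶠ w in 𝓝 (0 : Rd d), ‖projPerp ν w‖ ≤ 2 * ‖F w - x₀‖ := by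
    filter_upwards [hpF, g.eventually_proj] with w hw1 hw2
    rw [← hw2]
    refine (norm_projPerp_le g.norm_eq _).trans ?_
    have h1 := h.norm_closestPoint_sub_le hε hΘ hw1.2.2 hpF.self_of_nhds.2.2
    rwa [hw1.1, hpF.self_of_nhds.1, g.map_zero, hF0] at h1
  have hB2 : ∀ᶠ w in 𝓝 (0 : Rd d), |inner ℝ ν w| ≤ ‖F w - x₀‖ := by
    have h1 : ∀ᶠ w in 𝓝 (0 : Rd d), |(inner ℝ ν w : ℝ)| ≤ |(|t₀ + inner ℝ ν w| - |t₀|)| := by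
      rcases eq_or_ne t₀ 0 with h0 | h0
      · exact Eventually.of_forall fun w => abs_le_abs_abs_add_sub_abs (Or.inl h0)
      · have h2 := hτ.abs
        rw [abs_zero] at h2
        filter_upwards [h2.eventually (gt_mem_nhds (abs_pos.2 h0))] with w hw
        exact abs_le_abs_abs_add_sub_abs (Or.inr hw)
    filter_upwards [hpF, h1] with w hw1 hw2
    refine hw2.trans ?_
    have h3 := hpF.self_of_nhds.2.1
    rw [hF0, inner_zero_right, add_zero] at h3
    rw [← hw1.2.1, ← h3, ← Real.dist_eq, ← dist_eq_norm]
    simpa using (Metric.lipschitz_infDist_pt Θ).dist_le_mul (F w) x₀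
  have hFd := (hFc.differentiableAt (by norm_num)).hasFDerivAt
  have hinj : Function.Injective (fderiv ℝ F 0) := by
    refine injective_of_norm_le hFd (C := 3) ?_
    filter_upwards [hB1, hB2] with w hw1 hw2
    have h1 : w = projPerp ν w + inner ℝ ν w • ν := by rw [projPerp_apply]; abel
    have h2 : ‖w‖ ≤ ‖projPerp ν w‖ + |inner ℝ ν w| := by
      conv_lhs => rw [h1]
      refine (norm_add_le _ _).trans ?_
      rw [norm_smul, g.norm_eq, mul_one, Real.norm_eq_abs]
    rw [hF0]
    linarith
  obtain ⟨e, he⟩ := exists_continuousLinearEquiv_of_injective hinj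
  have hFe : HasFDerivAt F (e : Rd d →L[ℝ] Rd d) 0 := by rwa [he]
  set W := hFc.localInverse hFe (by norm_num) with hW
  have hWc : ContDiffAt ℝ 2 W x₀ := by
    have := hFc.to_localInverse hFe (by norm_num)
    rwa [hF0] at this
  have hW0 : W x₀ = 0 := by
    have := hFc.localInverse_apply_image hFe (by norm_num)
    rwa [hF0] at this
  have hWr : ∀ᶠ x in 𝓝 x₀, F (W x) = x := by
    have := (hFc.hasStrictFDerivAt' hFe (by norm_num)).eventually_right_inverse
    rwa [hF0] at this
  have hWt : Tendsto W (𝓝 x₀) (𝓝 0) := by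
    have := hWc.continuousAt.tendsto
    rwa [hW0] at this
  refine ⟨W, hWc, hW0, ?_⟩
  filter_upwards [hWr, hWt.eventually hmem, hWt.eventually hpF, hWt.eventually hB1,
    hWt.eventually hB2] with x h1 h2 h3 h4 h5
  rw [h1] at h3 h4 h5
  exact ⟨h2, h3.1, h1.symm, h4, h5⟩

end Coordinates

/-! ### The derivative of the transform -/

section Transform

variable {d : ℕ} {Θ : Set (Rd d)} {ε : ℝ} {ξ ν : Rd d} {ψ : Rd d → Rd d}

lemma IsLocalGraph.coe_orthogonalProjectionOnto (g : IsLocalGraph Θ ξ ν ψ) (w : Rd d) :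
    ((tangentSpaceAt Θ ξ).orthogonalProjectionOnto w : Rd d) = projPerp ν w := by
  rw [Submodule.coe_orthogonalProjectionOnto_apply]
  refine Submodule.eq_starProjection_of_mem_of_inner_eq_zero ?_ ?_
  · rw [g.tangentSpaceAt_eq, Submodule.mem_orthogonal_singleton_iff_inner_right]
    exact inner_projPerp g.norm_eq w
  · intro v hv
    rw [g.tangentSpaceAt_eq, Submodule.mem_orthogonal_singleton_iff_inner_right] at hv
    rw [projPerp_apply, sub_sub_cancel, real_inner_smul_left, hv, mul_zero]

lemma IsLocalGraph.isTangentGraph (g : IsLocalGraph Θ ξ ν ψ) :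
    IsTangentGraph 3 Θ ξ fun v => ψ v := by
  have hc : Tendsto (fun v : tangentSpaceAt Θ ξ => (v : Rd d)) (𝓝 0) (𝓝 0) := by
    simpa using (tangentSpaceAt Θ ξ).subtypeL.continuous.tendsto 0
  refine ⟨?_, g.map_zero, hc.eventually g.eventually_mem, ?_⟩
  · have h1 : ContDiffAt ℝ 3 ψ ((tangentSpaceAt Θ ξ).subtypeL 0) := by
      rw [_root_.map_zero]
      exact g.contDiffAt
    exact h1.comp (0 : tangentSpaceAt Θ ξ) (tangentSpaceAt Θ ξ).subtypeL.contDiff.contDiffAt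
  · filter_upwards [hc.eventually g.eventually_proj] with v hv
    ext1
    rw [g.coe_orthogonalProjectionOnto, hv]
    refine projPerp_of_inner_eq_zero ?_
    exact Submodule.mem_orthogonal_singleton_iff_inner_right.1 (g.tangentSpaceAt_eq.le v.2)

/-- The displacement `G - id` is `C¹` near `Θ`, with derivative of order `c`: in normal coordinates it
is the product of `profile c` of the signed distance and of `α` at the closest point. -/
theorem contDiffAt_transform_sub (hε : 0 < ε)
    (h : HasUniqueClosestPoints Θ ε) (hΘ : IsHypersurface 3 Θ) {μ : Rd d → Rd d}
    (hμ : IntrinsicLipschitzOn μ Θᶜ) (σ : Rd d → Matrix (Fin d) (Fin d) ℝ) {a : ℝ}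
    (hα : ∀ (V : Set (Rd d)) (n : Rd d → Rd d), IsUnitNormalFieldOn Θ V n →
      IsCkOn 3 (fun ξ => alpha μ σ (n ξ) ξ) (Θ ∩ V) ∧
        ∀ ξ ∈ Θ ∩ V, DerivsBoundedAt 3 Θ (fun ζ => alpha μ σ (n ζ) ζ) ξ a)
    {c : ℝ} (hc : 0 < c) {x₀ : Rd d} (hx₀ : x₀ ∈ Metric.thickening (ε / 4) Θ) :
    ContDiffAt ℝ 1 (fun x => transform μ σ Θ ε c x - x) x₀ ∧
      ‖fderiv ℝ (fun x => transform μ σ Θ ε c x - x) x₀‖ ≤ 8 * c * a + 2 * c ^ 2 * a := by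
  have hx₀' : x₀ ∈ Metric.thickening ε Θ := Metric.thickening_mono (by linarith) Θ hx₀
  have hcl := h.isClosestPoint_closestPoint hx₀'
  set ξ := closestPoint Θ x₀ with hξ
  obtain ⟨V, n, hV, hξV, hn, hg⟩ := hΘ.exists_isLocalGraph hcl.1
  obtain ⟨ψ, g⟩ := hg ξ ⟨hcl.1, hξV⟩
  have hfield : IsUnitNormalFieldOn Θ V n := by
    refine ⟨hV, fun ζ hζ => ?_, fun ζ hζ => ⟨V, hV, hζ.2, n, hn, fun _ _ => rfl⟩⟩
    obtain ⟨ψ', g'⟩ := hg ζ hζ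
    exact g'.isUnitNormal
  obtain ⟨hαc, hαb⟩ := hα V n hfield
  set ν := n ξ with hν
  set t₀ : ℝ := inner ℝ ν (x₀ - ξ) with ht₀
  have hx₀e : x₀ = ξ + t₀ • ν := g.eq_add_smul hcl
  have ht₀ε : |t₀| < ε / 4 := by
    have h1 := (infDist_lt_of_mem_thickening hx₀).2
    rw [← hcl.2] at h1
    nth_rw 1 [hx₀e] at h1
    rwa [dist_eq_norm, add_sub_cancel_left, norm_smul, g.norm_eq, mul_one, Real.norm_eq_abs] at h1
  obtain ⟨W, hWc, hW0, hW⟩ := g.exists_coordinates hε h hΘ hV hξV hn hg ht₀ε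
  rw [← hν, ← hx₀e] at hWc hW0 hW
  -- `B` is `α` in the graph parametrization over the tangent space, where its derivatives are bounded
  set T := tangentSpaceAt Θ ξ with hT
  set α : Rd d → Rd d := fun ζ => alpha μ σ (n ζ) ζ with hαdef
  set B : T → Rd d := fun v => α (ψ v) with hB
  have hbd := hαb ξ ⟨hcl.1, hξV⟩ _ g.isTangentGraph
  have hB0 : ‖B 0‖ ≤ a := by
    have := hbd 0 (by norm_num)
    rwa [norm_iteratedFDeriv_zero] at this
  have hB1 : ‖fderiv ℝ B 0‖ ≤ a := by
    have := hbd 1 (by norm_num)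
    rwa [norm_iteratedFDeriv_one] at this
  have ha : 0 ≤ a := (norm_nonneg _).trans hB0
  have hBc : ContDiffAt ℝ 1 B 0 := by
    obtain ⟨U, hU, hξU, k, hk, hkα⟩ := hαc ξ ⟨hcl.1, hξV⟩
    have hk1 : ContDiffAt ℝ 1 k ξ :=
      (hk.contDiffAt (hU.mem_nhds hξU)).of_le (by exact_mod_cast (by norm_num : (1 : ℕ∞) ≤ 3))
    have h1 : ContDiffAt ℝ 3 (fun v : T => ψ v) 0 := g.isTangentGraph.contDiffAt
    have h2 : ContDiffAt ℝ 1 (fun v : T => k (ψ v)) 0 := by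
      refine ContDiffAt.comp (0 : T) ?_ (h1.of_le (by norm_num))
      rw [ZeroMemClass.coe_zero, g.map_zero]
      exact hk1
    refine h2.congr_of_eventuallyEq ?_
    have h3 : ∀ᶠ v : T in 𝓝 0, ψ v ∈ V ∩ U := by
      refine h1.continuousAt.eventually_mem ?_
      rw [ZeroMemClass.coe_zero, g.map_zero]
      exact (hV.inter hU).mem_nhds ⟨hξV, hξU⟩
    filter_upwards [h3, g.isTangentGraph.eventually_mem] with v hv1 hv2
    exact hkα ⟨⟨hv2, hv1.1⟩, hv1.2⟩
  set s : Rd d → ℝ := fun x => t₀ + inner ℝ ν (W x) with hs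
  set v : Rd d → T := fun x => T.orthogonalProjectionOnto (W x) with hv
  have hs0 : s x₀ = t₀ := by simp [hs, hW0]
  have hv0 : v x₀ = 0 := by simp [hv, hW0]
  have hW1 : ContDiffAt ℝ 1 W x₀ := hWc.of_le (by norm_num)
  have hsc : ContDiffAt ℝ 1 s x₀ := contDiffAt_const.add (contDiffAt_const.inner ℝ hW1)
  have hvc : ContDiffAt ℝ 1 v x₀ := T.orthogonalProjectionOnto.contDiff.contDiffAt.comp x₀ hW1
  have hRe : (fun x => transform μ σ Θ ε c x - x) =ᶠ[𝓝 x₀] fun x => profile c (s x) • B (v x) := by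
    filter_upwards [hW, Metric.isOpen_thickening.mem_nhds hx₀'] with x hx hxε
    obtain ⟨hx1, hx2, hx3, -, -⟩ := hx
    obtain ⟨ψ', g'⟩ := hg _ hx1
    have h1 : B (v x) = α (ψ (W x)) := by
      simp only [hB, hv]
      rw [g.coe_orthogonalProjectionOnto, g.map_projPerp]
    have h2 : phiTilde c (ψ (W x)) (n (ψ (W x))) x = profile c (s x) := by
      have h3 : x - ψ (W x) = s x • n (ψ (W x)) := sub_eq_iff_eq_add'.2 hx3
      rw [phiTilde, h3, norm_smul, g'.norm_eq, real_inner_smul_left, real_inner_self_eq_norm_sq,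
        g'.norm_eq, profile, Real.norm_eq_abs]
      ring_nf
    rw [transform, if_pos hxε, add_sub_cancel_left, hx2, g'.phiTilde_smul_alpha hε h hμ σ, h2, h1]
  have hpc : ContDiffAt ℝ 1 (fun x => profile c (s x)) x₀ :=
    (contDiff_profile hc).contDiffAt.comp x₀ hsc
  have hBv : ContDiffAt ℝ 1 (fun x => B (v x)) x₀ := by
    refine ContDiffAt.comp (g := B) x₀ ?_ hvc
    rwa [hv0]
  refine ⟨(hpc.smul hBv).congr_of_eventuallyEq hRe, ?_⟩
  have hs' := (hsc.differentiableAt one_ne_zero).hasFDerivAt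
  have hv' := (hvc.differentiableAt one_ne_zero).hasFDerivAt
  have hsn : ‖fderiv ℝ s x₀‖ ≤ 1 := by
    refine hs'.le_of_lip' zero_le_one ?_
    filter_upwards [hW] with x hx
    rw [hs0, hs, one_mul, add_sub_cancel_left, Real.norm_eq_abs]
    exact hx.2.2.2.2
  have hvn : ‖fderiv ℝ v x₀‖ ≤ 2 := by
    refine hv'.le_of_lip' zero_le_two ?_
    filter_upwards [hW] with x hx
    rw [hv0, sub_zero]
    change ‖(T.orthogonalProjectionOnto (W x) : Rd d)‖ ≤ 2 * ‖x - x₀‖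
    rw [g.coe_orthogonalProjectionOnto]
    exact hx.2.2.2.1
  have hB' : HasFDerivAt B (fderiv ℝ B 0) (v x₀) := by
    rw [hv0]
    exact (hBc.differentiableAt one_ne_zero).hasFDerivAt
  have hp' : HasDerivAt (profile c) (deriv (profile c) t₀) (s x₀) := by
    rw [hs0]
    exact (hasDerivAt_profile hc t₀).differentiableAt.hasDerivAt
  have hR' := (hp'.comp_hasFDerivAt x₀ hs').smul (hB'.comp x₀ hv')
  rw [hRe.fderiv_eq]
  have h0 : fderiv ℝ (fun x => profile c (s x) • B (v x)) x₀ = _ := hR'.fderiv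
  rw [h0]
  simp only [Function.comp_apply, hs0, hv0]
  refine (norm_add_le _ _).trans ?_
  rw [ContinuousLinearMap.norm_smulRight_apply, norm_smul, norm_smul, Real.norm_eq_abs,
    Real.norm_eq_abs]
  have h1 : ‖(fderiv ℝ B 0).comp (fderiv ℝ v x₀)‖ ≤ a * 2 :=
    (ContinuousLinearMap.opNorm_comp_le _ _).trans (by gcongr)
  have h2 := abs_profile_le hc t₀
  have h3 := abs_deriv_profile_le hc t₀
  calc _ ≤ c ^ 2 * (a * 2) + 8 * c * 1 * a := by gcongr
    _ = _ := by ring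

end Transform

/-! ### Small perturbations of the identity -/

section Diffeo

variable {d : ℕ}

lemma transform_eq_self {Θ : Set (Rd d)} {ε : ℝ} (h : HasUniqueClosestPoints Θ ε)
    (μ : Rd d → Rd d) (σ : Rd d → Matrix (Fin d) (Fin d) ℝ) {c : ℝ} (hc : 0 < c) {x : Rd d}
    (hx : x ∉ Metric.cthickening c Θ) : transform μ σ Θ ε c x = x := by
  rw [transform]
  split_ifs with hxε
  · have hcl := h.isClosestPoint_closestPoint hxε
    have h1 : c < ‖x - closestPoint Θ x‖ := by
      rw [← dist_eq_norm]
      by_contra! hle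
      exact hx (Metric.mem_cthickening_of_dist_le _ _ _ _ hcl.1 hle)
    have h2 : bump (‖x - closestPoint Θ x‖ / c) = 0 := by
      rw [bump, if_neg]
      rw [abs_of_nonneg (by positivity), not_le, one_lt_div hc]
      exact h1
    rw [phiTilde, h2, mul_zero, zero_smul, add_zero]
  · rfl

/-- A `C¹` map whose difference from the identity has derivative of norm at most `1 / 2` is a `C¹`
diffeomorphism. -/
theorem exists_diffeomorph_of_norm_fderiv_sub_le {G : Rd d → Rd d}
    (hc : ContDiff ℝ 1 fun x => G x - x) (hb : ∀ x, ‖fderiv ℝ (fun x => G x - x) x‖ ≤ 1 / 2) :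
    ∃ Φ : Rd d ≃ₘ^1⟮𝓘(ℝ, Rd d), 𝓘(ℝ, Rd d)⟯ Rd d, ∀ x, Φ x = G x := by
  set R : Rd d → Rd d := fun x => G x - x with hR
  have hGR : G = fun x => x + R x := by
    funext x
    simp [hR]
  have hGc : ContDiff ℝ 1 G := by
    rw [hGR]
    exact contDiff_id.add hc
  have hRd : Differentiable ℝ R := hc.differentiable one_ne_zero
  have hlip : LipschitzWith (1 / 2) R := by
    refine lipschitzWith_of_nnnorm_fderiv_le hRd fun x => ?_
    rw [← NNReal.coe_le_coe, coe_nnnorm]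
    simpa using hb x
  have happ : ApproximatesLinearOn G
      ((ContinuousLinearEquiv.refl ℝ (Rd d) : Rd d ≃L[ℝ] Rd d) : Rd d →L[ℝ] Rd d) univ (1 / 2) := by
    intro x _ y _
    have h1 : G x - G y - (x - y) = R x - R y := by
      simp only [hR]
      abel
    change ‖G x - G y - (x - y)‖ ≤ _
    rw [h1]
    exact hlip.norm_sub_le x y
  have hN : Subsingleton (Rd d) ∨ (1 / 2 : ℝ≥0) <
      ‖((ContinuousLinearEquiv.refl ℝ (Rd d)).symm : Rd d →L[ℝ] Rd d)‖₊⁻¹ := by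
    rcases subsingleton_or_nontrivial (Rd d) with h | h
    · exact Or.inl h
    · right
      have h1 : ‖((ContinuousLinearEquiv.refl ℝ (Rd d)).symm : Rd d →L[ℝ] Rd d)‖₊ = 1 :=
        NNReal.eq ContinuousLinearMap.norm_id
      rw [h1, inv_one]
      exact NNReal.half_lt_self one_ne_zero
  set e := happ.toHomeomorph G hN with he
  have heG : ∀ x, e x = G x := fun _ => rfl
  have hderiv : ∀ x, ∃ L : Rd d ≃L[ℝ] Rd d, HasFDerivAt G (L : Rd d →L[ℝ] Rd d) x := by
    intro x
    have h1 : HasFDerivAt G (ContinuousLinearMap.id ℝ (Rd d) + fderiv ℝ R x) x := by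
      rw [hGR]
      exact (hasFDerivAt_id x).add (hRd x).hasFDerivAt
    have hinj : Function.Injective (ContinuousLinearMap.id ℝ (Rd d) + fderiv ℝ R x) := by
      rw [injective_iff_map_eq_zero]
      intro w hw
      have h2 : w = -fderiv ℝ R x w := eq_neg_of_add_eq_zero_left hw
      have h3 : ‖w‖ ≤ 1 / 2 * ‖w‖ := by
        conv_lhs => rw [h2]
        rw [norm_neg]
        exact (fderiv ℝ R x).le_of_opNorm_le (hb x) w
      exact norm_eq_zero.1 (by linarith [norm_nonneg w])
    obtain ⟨L, hL⟩ := exists_continuousLinearEquiv_of_injective hinj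
    exact ⟨L, by rwa [hL]⟩
  choose L hL using hderiv
  refine ⟨⟨e.toEquiv, ?_, ?_⟩, heG⟩
  · exact hGc.contMDiff
  · exact (e.contDiff_symm (f₀' := L) hL hGc).contMDiff

end Diffeo

end DriftTransform

theorem mainTheorem3 (d : ℕ)
    (μ : DriftTransform.Rd d → DriftTransform.Rd d)
    (σ : DriftTransform.Rd d → Matrix (Fin d) (Fin d) ℝ)
    (Θ : Set (DriftTransform.Rd d))
    (hμ : DriftTransform.IsExceptionalSet μ Θ)
    (hΘ : DriftTransform.IsHypersurface 3 Θ)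
    (ε₀ : ℝ) (hε₀ : 0 < ε₀)
    (hreach : DriftTransform.HasUniqueClosestPoints Θ ε₀)
    (hσ : ∃ c₀ > (0 : ℝ), ∀ ξ ∈ Θ, ∀ ν, DriftTransform.IsUnitNormal Θ ξ ν →
      c₀ ≤ ‖DriftTransform.transposeMul σ ξ ν‖)
    (hα : ∃ a : ℝ, ∀ (V : Set (DriftTransform.Rd d))
      (n : DriftTransform.Rd d → DriftTransform.Rd d),
      DriftTransform.IsUnitNormalFieldOn Θ V n →
        DriftTransform.IsCkOn 3 (fun ξ => DriftTransform.alpha μ σ (n ξ) ξ) (Θ ∩ V) ∧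
        ∀ ξ ∈ Θ ∩ V,
          DriftTransform.DerivsBoundedAt 3 Θ (fun ζ => DriftTransform.alpha μ σ (n ζ) ζ) ξ a) :
    ∃ cmax > (0 : ℝ), cmax ≤ ε₀ ∧ ∀ c : ℝ, 0 < c → c < cmax →
      ∃ Φ : DriftTransform.Rd d ≃ₘ^1⟮𝓘(ℝ, DriftTransform.Rd d), 𝓘(ℝ, DriftTransform.Rd d)⟯
          DriftTransform.Rd d,
        ∀ x, Φ x = DriftTransform.transform μ σ Θ ε₀ c x := by
  obtain ⟨a, ha⟩ := hα
  -- the derivative of `G - id` is bounded by `8 c a + 2 c² a ≤ 10 c |a|` if `c ≤ 1`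
  refine ⟨min (ε₀ / 4) (min 1 (1 / (20 * (|a| + 1)))),
    lt_min (by positivity) (lt_min one_pos (by positivity)),
    (min_le_left _ _).trans (by linarith), fun c hc hcmax => ?_⟩
  have hc1 : c < ε₀ / 4 := hcmax.trans_le (min_le_left _ _)
  have hc2 : c < 1 := hcmax.trans_le ((min_le_right _ _).trans (min_le_left _ _))
  have hc3 : c * (20 * (|a| + 1)) ≤ 1 := by
    rw [← le_div_iff₀ (by positivity)]
    exact (hcmax.trans_le ((min_le_right _ _).trans (min_le_right _ _))).le
  have key : ∀ x₀, ContDiffAt ℝ 1 (fun x => DriftTransform.transform μ σ Θ ε₀ c x - x) x₀ ∧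
      ‖fderiv ℝ (fun x => DriftTransform.transform μ σ Θ ε₀ c x - x) x₀‖ ≤ 1 / 2 := by
    intro x₀
    by_cases hx₀ : x₀ ∈ Metric.thickening (ε₀ / 4) Θ
    · have h1 := DriftTransform.contDiffAt_transform_sub hε₀ hreach hΘ hμ.2.2 σ ha hc hx₀
      refine ⟨h1.1, h1.2.trans ?_⟩
      have h2 : c * a ≤ c * |a| := by gcongr; exact le_abs_self a
      have h3 : c ^ 2 * a ≤ c * |a| := by
        calc c ^ 2 * a ≤ c ^ 2 * |a| := by gcongr; exact le_abs_self a
          _ ≤ c * |a| := by gcongr; nlinarith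
      nlinarith
    · have h1 : (fun x => DriftTransform.transform μ σ Θ ε₀ c x - x) =ᶠ[𝓝 x₀] fun _ => 0 := by
        have h2 : x₀ ∈ (Metric.cthickening c Θ)ᶜ := fun h3 =>
          hx₀ (Metric.cthickening_subset_thickening' (by positivity) hc1 Θ h3)
        filter_upwards [Metric.isClosed_cthickening.isOpen_compl.mem_nhds h2] with x hx
        rw [DriftTransform.transform_eq_self hreach μ σ hc hx, sub_self]
      refine ⟨contDiffAt_const.congr_of_eventuallyEq h1, ?_⟩
      rw [h1.fderiv_eq]
      simp
  exact DriftTransform.exists_diffeomorph_of_norm_fderiv_sub_le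
    (contDiff_iff_contDiffAt.2 fun x => (key x).1) fun x => (key x).2
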